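/- Let $(A,\mathfrak m)$ be a Noetherian local ring with infinite residue field, $I$ an $\mathfrak m$-primary ideal, and $M$ a finitely generated $A$-module of Krull dimension $1$. Let $G=\bigoplus_{n\ge 0} I^n/I^{n+1}$ be the associated graded ring of $I$, and let $G_I(M)=\bigoplus_{n\ge 0} I^nM/I^{n+1}M$ be the associated graded module of $M$, a graded $G$-module. For a finitely generated graded $G$-module $E$ put $a_i(E)=\sup\{n\in\mathbb Z : H^i_{G_+}(E)_n\neq 0\}$, where $G_+=\bigoplus_{n>0}I^n/I^{n+1}$ (and $a_i(E)=-\infty$ if $H^i_{G_+}(E)=0$), and let $\operatorname{reg}(E)=\max\{a_i(E)+i : 0\le i\le \dim E\}$ be its Castelnuovo-Mumford regularity. Let $e_0,e_1\in\mathbb Z$ be the Hilbert coefficients of $M$ with respect to $I$, i.e. the integers with $\ell(M/I^{n+1}M)=e_0(n+1)-e_1$ for all $n\gg 0$. Let $b$ be the largest integer with $IM\subseteq \mathfrak m^bM$. Then $$\operatorname{reg}(G_I(M))\le \binom{e_0-b+2}{2}-e_1-1 .$$ -/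

import Mathlib

open scoped DirectSum

/-! ### The associated graded ring and the associated graded module -/

namespace AssocGr

section

variable {A : Type*} [CommRing A] (I : Ideal A) (M : Type*) [AddCommGroup M] [Module A M]

/-- The submodule `I ^ n M` of `M`. -/
abbrev powSub (n : ℕ) : Submodule A M := I ^ n • (⊤ : Submodule A M)

/-- The component `I ^ n M / I ^ (n + 1) M` of degree `n`. -/
abbrev Piece (n : ℕ) : Type _ :=
  ↥(powSub I M n) ⧸ (powSub I M (n + 1)).submoduleOf (powSub I M n)

/-- The class in `I ^ n M / I ^ (n + 1) M` of an element of `I ^ n M`. -/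
abbrev cls (n : ℕ) (m : M) (hm : m ∈ powSub I M n) : Piece I M n :=
  Submodule.Quotient.mk (⟨m, hm⟩ : powSub I M n)

variable {M}

theorem smul_mem_powSub {i j : ℕ} {a : A} {m : M} (ha : a ∈ powSub I A i)
    (hm : m ∈ powSub I M j) : a • m ∈ powSub I M (i + j) := by
  have ha' : a ∈ I ^ i := by simpa [powSub] using ha
  rw [powSub, pow_add, mul_smul]
  exact Submodule.smul_mem_smul ha' hm

/-- Equality of classes in components whose degrees agree only propositionally. -/
theorem mk_cls_eq {i j : ℕ} (h : i = j) {m m' : M} (e : m = m') (hm : m ∈ powSub I M i)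
    (hm' : m' ∈ powSub I M j) :
    (⟨i, cls I M i m hm⟩ : GradedMonoid (Piece I M)) = ⟨j, cls I M j m' hm'⟩ := by
  subst h; subst e; rfl

variable (M)

/-- Multiplication `I ^ i M / I ^ (i + 1) M → I ^ (i + j) M / I ^ (i + j + 1) M` by an element
of `I ^ j`, and its descent to `I ^ j / I ^ (j + 1)`:
`(a + I ^ (i + 1), m + I ^ (j + 1) M) ↦ a m + I ^ (i + j + 1) M`. -/
def pieceSMul (i j : ℕ) : Piece I A i →ₗ[A] Piece I M j →ₗ[A] Piece I M (i + j) :=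
  Submodule.liftQ _
    { toFun := fun a => Submodule.mapQ _ _
        { toFun := fun m => ⟨(a : A) • (m : M), smul_mem_powSub I a.2 m.2⟩
          map_add' := fun m m' => Subtype.ext (smul_add _ _ _)
          map_smul' := fun c m => Subtype.ext (smul_comm _ _ _) }
        (fun m hm => smul_mem_powSub I (j := j + 1) a.2 hm)
      map_add' := fun a a' => Submodule.linearMap_qext _ (LinearMap.ext fun m =>
        congrArg (Submodule.Quotient.mk) (Subtype.ext (add_smul (a : A) (a' : A) (m : M))))
      map_smul' := fun c a => Submodule.linearMap_qext _ (LinearMap.ext fun m =>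
        congrArg (Submodule.Quotient.mk) (Subtype.ext (smul_assoc c (a : A) (m : M)))) }
    (fun a ha => Submodule.linearMap_qext _ (LinearMap.ext fun m => by
      refine (Submodule.Quotient.mk_eq_zero _).2 ?_
      have h : (a : A) • (m : M) ∈ powSub I M ((i + 1) + j) :=
        smul_mem_powSub I (i := i + 1) (Submodule.mem_comap.1 ha) m.2
      rw [Nat.add_right_comm] at h
      exact h))

theorem pieceSMul_cls {i j : ℕ} {a : A} {m : M} (ha : a ∈ powSub I A i) (hm : m ∈ powSub I M j) :
    pieceSMul I M i j (cls I A i a ha) (cls I M j m hm) =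
      cls I M (i + j) (a • m) (smul_mem_powSub I ha hm) := rfl

theorem one_mem_powSub : (1 : A) ∈ powSub I A 0 := by simp [powSub]

instance gMul : GradedMonoid.GMul (Piece I A) where
  mul a b := pieceSMul I A _ _ a b

instance gOne : GradedMonoid.GOne (Piece I A) where
  one := cls I A 0 1 (one_mem_powSub I)

/-- The graded ring structure on the family `I ^ n / I ^ (n + 1)`. -/
instance gCommRing : DirectSum.GCommRing (Piece I A) where
  mul_zero a := map_zero (pieceSMul I A _ _ a)
  zero_mul b := by
    change pieceSMul I A _ _ 0 b = 0
    simp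
  mul_add a b c := map_add (pieceSMul I A _ _ a) b c
  add_mul a b c := by
    change pieceSMul I A _ _ (a + b) c = pieceSMul I A _ _ a c + pieceSMul I A _ _ b c
    simp
  one_mul := by
    rintro ⟨i, a⟩
    obtain ⟨⟨a, ha⟩, rfl⟩ := Submodule.Quotient.mk_surjective _ a
    exact mk_cls_eq I (zero_add i) (one_mul a) _ _
  mul_one := by
    rintro ⟨i, a⟩
    obtain ⟨⟨a, ha⟩, rfl⟩ := Submodule.Quotient.mk_surjective _ a
    exact mk_cls_eq I (add_zero i) (mul_one a) _ _
  mul_assoc := by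
    rintro ⟨i, a⟩ ⟨j, b⟩ ⟨k, c⟩
    obtain ⟨⟨a, ha⟩, rfl⟩ := Submodule.Quotient.mk_surjective _ a
    obtain ⟨⟨b, hb⟩, rfl⟩ := Submodule.Quotient.mk_surjective _ b
    obtain ⟨⟨c, hc⟩, rfl⟩ := Submodule.Quotient.mk_surjective _ c
    exact mk_cls_eq I (add_assoc i j k) (mul_assoc a b c) _ _
  mul_comm := by
    rintro ⟨i, a⟩ ⟨j, b⟩
    obtain ⟨⟨a, ha⟩, rfl⟩ := Submodule.Quotient.mk_surjective _ a
    obtain ⟨⟨b, hb⟩, rfl⟩ := Submodule.Quotient.mk_surjective _ b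
    exact mk_cls_eq I (add_comm i j) (mul_comm a b) _ _
  natCast n := n • cls I A 0 1 (one_mem_powSub I)
  natCast_zero := zero_smul _ _
  natCast_succ n := succ_nsmul _ _
  intCast n := n • cls I A 0 1 (one_mem_powSub I)
  intCast_ofNat n := natCast_zsmul _ _
  intCast_negSucc_ofNat n := negSucc_zsmul _ _

/-- The graded module structure on the family `I ^ n M / I ^ (n + 1) M` over the graded ring
with components `I ^ n / I ^ (n + 1)`. -/
instance gModule : DirectSum.Gmodule (Piece I A) (Piece I M) where
  smul {i j} a m := pieceSMul I M i j a m
  one_smul := by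
    rintro ⟨i, m⟩
    obtain ⟨⟨m, hm⟩, rfl⟩ := Submodule.Quotient.mk_surjective _ m
    exact mk_cls_eq I (zero_add i) (one_smul A m) _ _
  mul_smul := by
    rintro ⟨i, a⟩ ⟨j, b⟩ ⟨k, m⟩
    obtain ⟨⟨a, ha⟩, rfl⟩ := Submodule.Quotient.mk_surjective _ a
    obtain ⟨⟨b, hb⟩, rfl⟩ := Submodule.Quotient.mk_surjective _ b
    obtain ⟨⟨m, hm⟩, rfl⟩ := Submodule.Quotient.mk_surjective _ m
    exact mk_cls_eq I (add_assoc i j k) (mul_smul a b m) _ _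
  smul_add a m m' := map_add _ _ _
  smul_zero a := map_zero _
  add_smul a b m := by
    change pieceSMul I M _ _ (a + b) m = pieceSMul I M _ _ a m + pieceSMul I M _ _ b m
    simp
  zero_smul m := by
    change pieceSMul I M _ _ 0 m = 0
    simp

/-- The associated graded module `G_I(M) = ⨁ n, I ^ n M / I ^ (n + 1) M`. For `M = A` it is the
associated graded ring `G = ⨁ n, I ^ n / I ^ (n + 1)`. -/
abbrev Gr : Type _ := ⨁ n, Piece I M n

/-- The homogeneous elements of degree `n` of `G_I(M)`. -/
def grDeg (n : ℕ) : AddSubgroup (Gr I M) := (DirectSum.of (Piece I M) n).range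

end

end AssocGr

/-! ### Graded local cohomology and Castelnuovo-Mumford regularity

Below, `R` is a standard graded ring with components `𝒜 n` (`n ≥ 0`), and `E` is a graded
`R`-module with components `ℳ n` (`n ≥ 0`). -/

namespace GradedCech

section

variable {R : Type*} [CommRing R] (𝒜 : ℕ → AddSubgroup R)
  {E : Type*} [AddCommGroup E] [Module R E] (ℳ : ℕ → AddSubgroup E)

/-- For a multiplicative set `S` generated by homogeneous elements, the component of degree
`n : ℤ` of `S⁻¹ E`: it consists of the fractions `m / t` with `m ∈ E` and `t ∈ S` homogeneous and
`deg m - deg t = n`. (These fractions already form a subgroup.) -/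
def locDeg (S : Submonoid R) (n : ℤ) : AddSubgroup (LocalizedModule S E) :=
  AddSubgroup.closure {z | ∃ (j k : ℕ) (m : E) (t : S),
    m ∈ ℳ j ∧ (t : R) ∈ 𝒜 k ∧ (j : ℤ) - k = n ∧ z = LocalizedModule.mk m t}

variable {s : ℕ} (x : Fin s → R)

/-- The multiplicative set generated by `x (α 0), …, x (α (p - 1))`; localizing at it is the same
as inverting the product of these elements. -/
abbrev cechSet {p : ℕ} (α : Fin p → Fin s) : Submonoid R :=
  Submonoid.closure (Set.range fun l => x (α l))

theorem cechSet_le {p : ℕ} (α : Fin (p + 1) → Fin s) (k : Fin (p + 1)) :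
    cechSet x (fun l => α (k.succAbove l)) ≤ cechSet x α :=
  Submonoid.closure_mono (by rintro _ ⟨l, rfl⟩; exact ⟨_, rfl⟩)

variable (E)

/-- The Čech cochains of degree `p` of `E` with respect to `x`: the product over all
`(α 0, …, α (p - 1))` of the localizations of `E` at `x (α 0) ⋯ x (α (p - 1))`; in degree
`p = 0` this is `E` itself. All tuples of indices are used, not only the increasing ones; the two
complexes have the same cohomology. -/
abbrev Cochain (p : ℕ) : Type _ := (α : Fin p → Fin s) → LocalizedModule (cechSet x α) E

/-- The Čech differential `(d c) α = ∑ k, (-1) ^ k c (α with its k-th entry omitted)`. -/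
noncomputable def cechD (p : ℕ) : Cochain E x p →ₗ[R] Cochain E x (p + 1) :=
  LinearMap.pi fun α => ∑ k : Fin (p + 1), ((-1 : R) ^ (k : ℕ)) •
    (LocalizedModule.liftOfLE (M := E) _ _ (cechSet_le x α k) ∘ₗ
      LinearMap.proj (fun l => α (k.succAbove l)))

variable {E}

/-- The cochains that are homogeneous of degree `n`. -/
def cochainDeg (n : ℤ) (p : ℕ) : AddSubgroup (Cochain E x p) :=
  AddSubgroup.pi Set.univ fun α => locDeg 𝒜 ℳ (cechSet x α) n

/-- The cocycles of cohomological degree `p` that are homogeneous of degree `n`. -/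
noncomputable def cocycles (n : ℤ) (p : ℕ) : AddSubgroup (Cochain E x p) :=
  cochainDeg 𝒜 ℳ x n p ⊓ (cechD E x p).toAddMonoidHom.ker

/-- The coboundaries of cohomological degree `p` that are homogeneous of degree `n`. -/
noncomputable def coboundaries (n : ℤ) : (p : ℕ) → AddSubgroup (Cochain E x p)
  | 0 => ⊥
  | p + 1 => (cochainDeg 𝒜 ℳ x n p).map (cechD E x p).toAddMonoidHom

/-- The component of degree `n` of the `p`-th Čech cohomology of `E` with respect to `x`. If the
homogeneous elements `x` generate the ideal `R₊`, and `R` is Noetherian, this is the component of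
degree `n` of the local cohomology module `H^p_{R₊}(E)`. -/
abbrev CechH (n : ℤ) (p : ℕ) : Type _ :=
  ↥(cocycles 𝒜 ℳ x n p) ⧸ (coboundaries 𝒜 ℳ x n p).addSubgroupOf (cocycles 𝒜 ℳ x n p)

/-- The ideal `R₊` generated by the elements of positive degree. -/
def irrelevant : Ideal R := Ideal.span (⋃ n : ℕ, (𝒜 (n + 1) : Set R))

/-- `H^p_{R₊}(E)_n ≠ 0`, where the local cohomology is computed by the Čech complex on a finite
system of generators of `R₊` of degree one. (The choice of the generators does not matter.) -/
def LocalCohomologyNonzero (p : ℕ) (n : ℤ) : Prop :=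
  ∃ (s : ℕ) (x : Fin s → R), (∀ l, x l ∈ 𝒜 1) ∧ Ideal.span (Set.range x) = irrelevant 𝒜 ∧
    Nontrivial (CechH 𝒜 ℳ x n p)

/-- `a_p(E) = sup {n | H^p_{R₊}(E)_n ≠ 0}`, equal to `-∞` if `H^p_{R₊}(E) = 0`. -/
noncomputable def aInv (p : ℕ) : EReal :=
  ⨆ (n : ℤ) (_ : LocalCohomologyNonzero 𝒜 ℳ p n), ((n : ℝ) : EReal)

/-- The Castelnuovo-Mumford regularity `reg(E) = max {a_p(E) + p | 0 ≤ p ≤ dim E}`. -/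
noncomputable def regularity : EReal :=
  ⨆ (p : ℕ) (_ : (p : WithBot ℕ∞) ≤ Module.supportDim R E), (aInv 𝒜 ℳ p + (p : EReal))

end

end GradedCech

/-! ### Hilbert coefficients -/

namespace HilbertSamuel

section

variable {A : Type*} [CommRing A] (I : Ideal A) (M : Type*) [AddCommGroup M] [Module A M]

/-- The Hilbert-Samuel function `n ↦ ℓ(M / I ^ (n + 1) M)`. -/
noncomputable def hilbertFun (n : ℕ) : ℕ :=
  (Module.length A (M ⧸ I ^ (n + 1) • (⊤ : Submodule A M))).toNat

variable (A) in
/-- The Krull dimension of `M` as a natural number. -/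
noncomputable def dim : ℕ := ((Module.supportDim A M).unbotD 0).toNat

/-- `e 0, …, e r` are the Hilbert coefficients of `M` with respect to `I`, where `r = dim M`:
`ℓ(M / I ^ (n + 1) M) = ∑ i ≤ r, (-1) ^ i e i (n + r - i choose r - i)` for all large `n`. -/
def IsHilbertCoeffs (e : ℕ → ℤ) : Prop :=
  (∀ i, dim A M < i → e i = 0) ∧
  ∀ᶠ n : ℕ in Filter.atTop, (hilbertFun I M n : ℤ) =
    ∑ i ∈ Finset.range (dim A M + 1),
      (-1) ^ i * e i * ((n + dim A M - i).choose (dim A M - i) : ℤ)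

open Classical in
/-- The Hilbert coefficient `e_i(I, M)`. -/
noncomputable def hilbertCoeff : ℕ → ℤ :=
  if h : ∃ e : ℕ → ℤ, IsHilbertCoeffs I M e then h.choose else 0

end

end HilbertSamuel

/-- The Castelnuovo-Mumford regularity of the associated graded module `G_I(M)`, as a graded
module over the associated graded ring `G`. -/
noncomputable def regGr {A : Type*} [CommRing A] (I : Ideal A) (M : Type*) [AddCommGroup M]
    [Module A M] : EReal :=
  GradedCech.regularity (R := AssocGr.Gr I A) (E := AssocGr.Gr I M) (AssocGr.grDeg I A)
    (AssocGr.grDeg I M)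

/-! Suppose that, for some x in I and some β, I^(n+1)M = x I^nM for n ≥ β, and the initial form of x
is injective on G_I(M) in degrees > β. Then G_I(M) is finite over (A/I)[X], hence of dimension at
most 1, and the Čech complex gives H^0 = 0 in degrees > β and H^1 = 0 in degrees ≥ β. So the
regularity is at most β (`regGr_le`), and it remains to find x with β bounded by the Hilbert
coefficients (`exists_regularity_bound`).

Let L be the submodule of elements killed by a power of I, put N = M/L, and let r be least such that
I^(r+1)N = x I^rN for some x in I. Such an r exists: otherwise ℓ(M/I^nM) would grow quadratically,
while a parameter in I bounds it linearly (`exists_powSub_succ_eq_smul`). The element x is regular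
on N, so e₀ = ℓ(N/xN) and e₁ = e₀ r - ℓ(N/I^rN) - ℓ(L). Beyond r, the filtration L ∩ I^nM drops
strictly until it is zero, so it vanishes for n > r + ℓ(L) (`inf_powSub_eq_bot_of_lt`), and β = r +
ℓ(L) has the required properties. In β + e₁ the length of L cancels; what is needed is a lower bound
for ℓ(N/I^rN).

This bound comes from the Eakin-Sathaye argument (`exists_map_actPow_eq`, `exists_powSub_eq_smul`):
by minimality of r, I^nN needs more than n generators for n ≤ r. Together with IN ⊆ 𝔪^b N this gives
ℓ(I^nN/I^(n+1)N) ≥ n + b. Summation yields ℓ(N/I^rN) ≥ rb + r(r-1)/2, and also e₀ ≥ b + r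
(`exists_reduction_bound`). These two inequalities imply the binomial bound. -/

/-! ### Pencils of linear maps and the Eakin-Sathaye theorem for one linear form -/

section GenericRank

variable {k : Type*} [Field k]

/-- If `f` has maximal rank in the pencil spanned by `f` and `g`, then `g` maps the kernel of `f`
into the range of `f`. -/
theorem LinearMap.apply_mem_range_of_finrank_range_le [Infinite k] {U W : Type*} [AddCommGroup U] [Module k U]
    [AddCommGroup W] [Module k W] [FiniteDimensional k U] (f g : U →ₗ[k] W)
    (h : ∀ c : k, Module.finrank k (range (c • f - g)) ≤ Module.finrank k (range f))
    {u : U} (hu : f u = 0) : g u ∈ range f := by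
  by_contra hg
  obtain ⟨s, hs⟩ := f.rangeRestrict.exists_rightInverse_of_surjective f.range_rangeRestrict
  have hfs : ∀ d : range f, f (s d) = d := fun d =>
    congrArg Subtype.val (LinearMap.congr_fun hs d)
  -- Since `g u` lies outside the range of `f`, `ι` is injective on a space of dimension one more
  -- than the rank of `f`. The goal is a `c` for which `c • f - g` has at least that rank.
  set ι : (range f × k) →ₗ[k] W := (range f).subtype.coprod (LinearMap.toSpanSingleton k W (g u))
  set ψ : (range f × k) →ₗ[k] W := g ∘ₗ s ∘ₗ LinearMap.fst k _ _
  have hι : ker ι = ⊥ := by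
    rw [LinearMap.ker_eq_bot']
    rintro ⟨d, c⟩ hdc
    have hdc' : (d : W) + c • g u = 0 := hdc
    have hc : c = 0 := by
      by_contra hc
      apply hg
      have : g u = c⁻¹ • (-(d : W)) := by
        rw [eq_neg_of_add_eq_zero_left hdc', neg_neg, smul_smul, inv_mul_cancel₀ hc, one_smul]
      rw [this]
      exact Submodule.smul_mem _ _ (Submodule.neg_mem _ d.2)
    subst hc
    simpa using hdc'
  obtain ⟨π, hπ⟩ := ι.exists_leftInverse_of_injective hι
  -- For `c` outside the finitely many eigenvalues of `π ∘ ψ`, the map `c • ι - ψ` is injective; an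
  -- infinite `k` has such a `c`.
  obtain ⟨c, hc⟩ := (Module.End.finite_hasEigenvalue (π ∘ₗ ψ)).infinite_compl.nonempty
  have hinj : Function.Injective (c • ι - ψ) := by
    rw [← LinearMap.ker_eq_bot, LinearMap.ker_eq_bot']
    intro v hv
    by_contra hv0
    refine hc (Module.End.hasEigenvalue_of_hasEigenvector (x := v)
      ⟨Module.End.mem_eigenspace_iff.2 ?_, hv0⟩)
    have h1 : c • ι v = ψ v := sub_eq_zero.1 hv
    have h2 : π (ι v) = v := LinearMap.congr_fun hπ v
    rw [LinearMap.comp_apply, ← h1, map_smul, h2]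
  have hle : range (c • ι - ψ) ≤ range (c • f - g) := by
    rintro _ ⟨⟨d, a⟩, rfl⟩
    -- As `f u = 0`, only `g` sees the second term and contributes `(c * a) • g u`.
    refine ⟨s d - (c * a) • u, ?_⟩
    have h1 : ι (d, a) = (d : W) + a • g u := rfl
    have h2 : ψ (d, a) = g (s d) := rfl
    simp only [LinearMap.sub_apply, LinearMap.smul_apply, map_sub, map_smul, hfs, hu, h1, h2]
    module
  have h1 := Submodule.finrank_mono hle
  rw [LinearMap.finrank_range_of_inj hinj, Module.finrank_prod, Module.finrank_self] at h1
  have := h c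
  omega

variable {E : Type*} [AddCommGroup E] [Module k E]

/-- The subspaces `V ^ n E₀`, for a space `V` of endomorphisms of `E` and a subspace `E₀`. -/
def actPow (V : Submodule k (Module.End k E)) (E₀ : Submodule k E) : ℕ → Submodule k E
  | 0 => E₀
  | n + 1 => Submodule.map₂ LinearMap.id V (actPow V E₀ n)

theorem apply_mem_actPow {V : Submodule k (Module.End k E)} {E₀ : Submodule k E} {n : ℕ}
    {v : Module.End k E} (hv : v ∈ V) {e : E} (he : e ∈ actPow V E₀ n) :
    v e ∈ actPow V E₀ (n + 1) :=
  Submodule.apply_mem_map₂ LinearMap.id hv he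

theorem actPow_map {V : Submodule k (Module.End k E)} (hV : ∀ f ∈ V, ∀ g ∈ V, f * g = g * f)
    (E₀ : Submodule k E) {v : Module.End k E} (hv : v ∈ V) (n : ℕ) :
    actPow V (E₀.map v) n = (actPow V E₀ n).map v := by
  induction n with
  | zero => rfl
  | succ n ih =>
    rw [actPow, ih]
    have hc : ∀ f ∈ V, ∀ e, f (v e) = v (f e) := fun f hf e =>
      LinearMap.congr_fun (hV f hf v hv) e
    apply le_antisymm
    · rw [Submodule.map₂_le]
      rintro f hf _ ⟨e, he, rfl⟩
      exact ⟨f e, apply_mem_actPow hf he, (hc f hf e).symm⟩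
    · rw [Submodule.map_le_iff_le_comap, actPow, Submodule.map₂_le]
      intro f hf e he
      rw [Submodule.mem_comap, LinearMap.id_apply, ← hc f hf]
      exact Submodule.apply_mem_map₂ LinearMap.id hf (Submodule.mem_map_of_mem he)

/-- The case of one linear form of the Eakin-Sathaye theorem: if `dim V ^ n E₀ ≤ n`, then
`V ^ n E₀ = v V ^ (n - 1) E₀` for some `v ∈ V`. -/
theorem exists_map_actPow_eq [Infinite k] {V : Submodule k (Module.End k E)}
    (hV : ∀ f ∈ V, ∀ g ∈ V, f * g = g * f) (n : ℕ) (E₀ : Submodule k E)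
    (hfin : ∀ i, FiniteDimensional k (actPow V E₀ i))
    (hn : Module.finrank k (actPow V E₀ (n + 1)) ≤ n + 1) :
    ∃ v ∈ V, actPow V E₀ (n + 1) = (actPow V E₀ n).map v := by
  induction n generalizing E₀ with
  | zero =>
    by_cases h0 : actPow V E₀ 1 = ⊥
    · refine ⟨0, V.zero_mem, ?_⟩
      rw [zero_add, h0, Submodule.map_zero]
    · obtain ⟨v, hv, hne⟩ : ∃ v ∈ V, (actPow V E₀ 0).map v ≠ ⊥ := by
        by_contra! hcon
        apply h0
        rw [eq_bot_iff, actPow, Submodule.map₂_le]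
        intro f hf e he
        rw [← hcon f hf]
        exact Submodule.mem_map_of_mem he
      refine ⟨v, hv, ?_⟩
      have := hfin 1
      have hle : (actPow V E₀ 0).map v ≤ actPow V E₀ 1 := by
        rintro _ ⟨e, he, rfl⟩
        exact apply_mem_actPow hv he
      refine (Submodule.eq_of_le_of_finrank_le hle ?_).symm
      refine hn.trans ?_
      have := hfin 0
      rw [zero_add, Nat.one_le_iff_ne_zero, Ne, Submodule.finrank_eq_zero]
      exact hne
  | succ n ih =>
    have := hfin (n + 1)
    have := hfin (n + 2)
    have hmap : ∀ f ∈ V, (actPow V E₀ (n + 1)).map f ≤ actPow V E₀ (n + 2) := by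
      rintro f hf _ ⟨e, he, rfl⟩
      exact apply_mem_actPow hf he
    obtain ⟨f, hf, hmax⟩ : ∃ f ∈ V, ∀ g ∈ V,
        Module.finrank k ((actPow V E₀ (n + 1)).map g) ≤
          Module.finrank k ((actPow V E₀ (n + 1)).map f) := by
      have hbd : (Set.range fun g : V =>
          Module.finrank k ((actPow V E₀ (n + 1)).map (g : Module.End k E))).Finite := by
        refine (Set.finite_Iic (Module.finrank k (actPow V E₀ (n + 2)))).subset ?_
        rintro _ ⟨g, rfl⟩
        exact Submodule.finrank_mono (hmap g g.2)
      obtain ⟨_, ⟨f, rfl⟩, hf⟩ := Set.exists_max_image _ id hbd (Set.range_nonempty _)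
      exact ⟨f, f.2, fun g hg => hf _ ⟨⟨g, hg⟩, rfl⟩⟩
    by_cases hsurj : actPow V E₀ (n + 2) = (actPow V E₀ (n + 1)).map f
    · exact ⟨f, hf, hsurj⟩
    have hlt := Submodule.finrank_lt_finrank_of_lt (lt_of_le_of_ne (hmap f hf) (Ne.symm hsurj))
    -- When `f` is not onto in the top degree, passing from `E₀` to its image under `f` lowers both
    -- the degree and the dimension bound by one.
    obtain ⟨v, hv, hveq⟩ := ih (E₀.map f)
      (fun i => by rw [actPow_map hV E₀ hf]; have := hfin i; infer_instance)
      (by rw [actPow_map hV E₀ hf]; exact Nat.le_of_lt_succ (hlt.trans_le hn))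
    rw [actPow_map hV E₀ hf, actPow_map hV E₀ hf] at hveq
    refine ⟨v, hv, le_antisymm ?_ (hmap v hv)⟩
    have hfv : (actPow V E₀ (n + 1)).map f ≤ (actPow V E₀ (n + 1)).map v := by
      rw [hveq]
      refine Submodule.map_mono ?_
      rintro _ ⟨e, he, rfl⟩
      exact apply_mem_actPow hf he
    rw [actPow, Submodule.map₂_le]
    intro g hg e he
    obtain ⟨_, ⟨d, hd, rfl⟩, hde⟩ : f e ∈ ((actPow V E₀ n).map f).map v := by
      rw [← hveq]; exact Submodule.mem_map_of_mem he
    have hvd : v d ∈ actPow V E₀ (n + 1) := apply_mem_actPow hv hd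
    have hker : f (e - v d) = 0 := by
      rw [map_sub, ← hde, sub_eq_zero]
      exact LinearMap.congr_fun (hV v hv f hf) d
    have hrange : ∀ h : Module.End k E, LinearMap.range (h.domRestrict (actPow V E₀ (n + 1))) =
        (actPow V E₀ (n + 1)).map h := fun h => LinearMap.range_domRestrict _ _
    -- Maximality of the rank of `f` enters here, through the pencil lemma.
    have hgker : g (e - v d) ∈ (actPow V E₀ (n + 1)).map f := by
      rw [← hrange f]
      refine LinearMap.apply_mem_range_of_finrank_range_le (f.domRestrict _) (g.domRestrict _)
        (fun c => ?_) (u := ⟨e - v d, Submodule.sub_mem _ he hvd⟩) hker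
      rw [hrange f]
      have := hrange (c • f - g)
      refine le_trans (le_of_eq ?_) (hmax (c • f - g) (V.sub_mem (V.smul_mem c hf) hg))
      rw [← this]
      rfl
    have : LinearMap.id (R := k) g e = g (e - v d) + v (g d) := by
      rw [LinearMap.id_apply, map_sub]
      have : v (g d) = g (v d) := LinearMap.congr_fun (hV v hv g hg) d
      rw [this, sub_add_cancel]
    rw [this]
    exact Submodule.add_mem _ (hfv hgker) (Submodule.mem_map_of_mem (apply_mem_actPow hg hd))

end GenericRank

/-! ### The fiber module ⨁ I^nM/𝔪I^nM -/

section FiberModule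

open IsLocalRing AssocGr
open scoped Pointwise

theorem smul_powSub_le {A : Type*} [CommRing A] {I : Ideal A} (M : Type*) [AddCommGroup M]
    [Module A M] {x : A} (hx : x ∈ I) (n : ℕ) : x • powSub I M n ≤ powSub I M (n + 1) := by
  rintro _ ⟨m, hm, rfl⟩
  rw [powSub, pow_succ', mul_smul]
  exact Submodule.smul_mem_smul hx hm

variable {A : Type*} [CommRing A] [IsLocalRing A] (I : Ideal A)
  (M : Type*) [AddCommGroup M] [Module A M]

/-- The reduction `N / 𝔪 N` of a submodule `N`. -/
abbrev ModMax {M : Type*} [AddCommGroup M] [Module A M] (N : Submodule A M) : Type _ :=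
  ↥N ⧸ (maximalIdeal A • ⊤ : Submodule A N)

noncomputable instance {M : Type*} [AddCommGroup M] [Module A M] (N : Submodule A M) :
    Module (ResidueField A) (ModMax N) :=
  inferInstanceAs (Module (A ⧸ maximalIdeal A) (ModMax N))

instance {M : Type*} [AddCommGroup M] [Module A M] (N : Submodule A M) :
    IsScalarTower A (ResidueField A) (ModMax N) :=
  inferInstanceAs (IsScalarTower A (A ⧸ maximalIdeal A) (ModMax N))

instance {M : Type*} [AddCommGroup M] [Module A M] [IsNoetherian A M] (N : Submodule A M) :
    Module.Finite (ResidueField A) (ModMax N) :=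
  Module.Finite.of_restrictScalars_finite A _ _

variable {I}

/-- Multiplication by `x ∈ I` from `I ^ n M` to `I ^ (n + 1) M`. -/
def powSubMul (x : I) (n : ℕ) : ↥(powSub I M n) →ₗ[A] ↥(powSub I M (n + 1)) :=
  (LinearMap.lsmul A M x).restrict fun m hm => by
    rw [powSub, pow_succ', mul_smul]
    exact Submodule.smul_mem_smul x.2 hm

/-- Multiplication by `x ∈ I` from `I ^ n M / 𝔪 I ^ n M` to `I ^ (n + 1) M / 𝔪 I ^ (n + 1) M`. -/
noncomputable def fiberMul (x : I) (n : ℕ) :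
    ModMax (powSub I M n) →ₗ[ResidueField A] ModMax (powSub I M (n + 1)) :=
  LinearMap.extendScalarsOfSurjective residue_surjective
    (Submodule.mapQ _ _ (powSubMul M x n) (by
      rw [← Submodule.map_le_iff_le_comap, Submodule.map_smul'']
      exact smul_mono_right _ le_top))

/-- The direct sum of the `I ^ n M / 𝔪 I ^ n M`. -/
abbrev FiberModule (I : Ideal A) : Type _ := ⨁ n, ModMax (powSub I M n)

/-- The action of `x ∈ I` on the direct sum of the `I ^ n M / 𝔪 I ^ n M`. -/
noncomputable def fiberAct (x : I) : Module.End (ResidueField A) (FiberModule M I) :=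
  DirectSum.toModule (ResidueField A) ℕ _ fun n =>
    DirectSum.lof (ResidueField A) ℕ (fun n => ModMax (powSub I M n)) (n + 1) ∘ₗ fiberMul M x n

theorem fiberAct_lof (x : I) (n : ℕ) (e : ModMax (powSub I M n)) :
    fiberAct M x (DirectSum.lof (ResidueField A) ℕ (fun n => ModMax (powSub I M n)) n e) =
      DirectSum.lof (ResidueField A) ℕ (fun n => ModMax (powSub I M n)) (n + 1)
        (fiberMul M x n e) := by
  rw [fiberAct, DirectSum.toModule_lof, LinearMap.comp_apply]

theorem fiberMul_mk (x : I) (n : ℕ) (m : powSub I M n) :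
    fiberMul M x n (Submodule.Quotient.mk m) = Submodule.Quotient.mk (powSubMul M x n m) := rfl

theorem fiberEnd_ext {f g : Module.End (ResidueField A) (FiberModule M I)}
    (h : ∀ n (m : powSub I M n),
      f (DirectSum.lof (ResidueField A) ℕ (fun n => ModMax (powSub I M n)) n
        (Submodule.Quotient.mk m)) =
      g (DirectSum.lof (ResidueField A) ℕ (fun n => ModMax (powSub I M n)) n
        (Submodule.Quotient.mk m))) : f = g := by
  refine DirectSum.linearMap_ext _ fun n => LinearMap.ext fun e => ?_
  obtain ⟨m, rfl⟩ := Submodule.Quotient.mk_surjective _ e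
  exact h n m

/-- The space of endomorphisms given by the elements of `I`. -/
noncomputable def fiberForms (I : Ideal A) :
    Submodule (ResidueField A) (Module.End (ResidueField A) (FiberModule M I)) where
  carrier := Set.range (fiberAct M (I := I))
  zero_mem' := ⟨0, fiberEnd_ext M fun n m => by
    rw [fiberAct_lof, fiberMul_mk]
    have : powSubMul M (0 : I) n m = 0 := Subtype.ext (zero_smul A (m : M))
    rw [this, Submodule.Quotient.mk_zero, map_zero, LinearMap.zero_apply]⟩
  add_mem' := by
    rintro _ _ ⟨x, rfl⟩ ⟨y, rfl⟩
    refine ⟨x + y, fiberEnd_ext M fun n m => ?_⟩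
    rw [LinearMap.add_apply, fiberAct_lof, fiberAct_lof, fiberAct_lof, ← map_add]
    exact congrArg _ (congrArg Submodule.Quotient.mk (Subtype.ext (add_smul (x : A) y (m : M))))
  smul_mem' := by
    rintro c _ ⟨x, rfl⟩
    obtain ⟨a, rfl⟩ := residue_surjective c
    refine ⟨a • x, fiberEnd_ext M fun n m => ?_⟩
    rw [LinearMap.smul_apply, fiberAct_lof, fiberAct_lof, ← map_smul]
    refine congrArg _ ?_
    change _ = algebraMap A (ResidueField A) a • _
    rw [algebraMap_smul]
    exact congrArg Submodule.Quotient.mk (Subtype.ext (mul_smul a (x : A) (m : M)))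

theorem fiberForms_comm : ∀ f ∈ fiberForms M I, ∀ g ∈ fiberForms M I, f * g = g * f := by
  rintro _ ⟨x, rfl⟩ _ ⟨y, rfl⟩
  refine fiberEnd_ext M fun n m => ?_
  simp only [Module.End.mul_apply, fiberAct_lof, fiberMul_mk]
  exact congrArg _ (congrArg Submodule.Quotient.mk (Subtype.ext (smul_comm (x : A) (y : A) (m : M))))

/-- Rests on I^(n+1)M = I · I^nM. It identifies the abstract subspaces of the Eakin-Sathaye argument
with the graded pieces of the fiber module. -/
theorem actPow_fiberForms (n : ℕ) :
    actPow (E := FiberModule M I) (fiberForms M I) (LinearMap.range (DirectSum.lof (ResidueField A) ℕ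
      (fun n => ModMax (powSub I M n)) 0)) n =
    LinearMap.range (DirectSum.lof (ResidueField A) ℕ (fun n => ModMax (powSub I M n)) n) := by
  induction n with
  | zero => rfl
  | succ n ih =>
    rw [actPow, ih]
    apply le_antisymm
    · rw [Submodule.map₂_le]
      rintro _ ⟨x, rfl⟩ _ ⟨e, rfl⟩
      exact ⟨_, (fiberAct_lof M x n e).symm⟩
    · rintro _ ⟨e, rfl⟩
      obtain ⟨⟨m, hm⟩, rfl⟩ := Submodule.Quotient.mk_surjective _ e
      have hm' : m ∈ I • powSub I M n := by rwa [powSub, ← mul_smul, ← pow_succ']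
      have key : ∀ m ∈ I • powSub I M n, ∃ hm : m ∈ powSub I M (n + 1),
          DirectSum.lof (ResidueField A) ℕ (fun n => ModMax (powSub I M n)) (n + 1)
            (Submodule.Quotient.mk ⟨m, hm⟩) ∈ Submodule.map₂ LinearMap.id (fiberForms M I)
            (LinearMap.range (DirectSum.lof (ResidueField A) ℕ
              (fun n => ModMax (powSub I M n)) n)) := by
        intro m hm
        induction hm using Submodule.smul_induction_on' with
        | smul x hx m hm =>
          refine ⟨(powSubMul M ⟨x, hx⟩ n ⟨m, hm⟩).2, ?_⟩
          have := Submodule.apply_mem_map₂ LinearMap.id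
            (show fiberAct M ⟨x, hx⟩ ∈ fiberForms M I from ⟨_, rfl⟩)
            (LinearMap.mem_range_self (DirectSum.lof (ResidueField A) ℕ
              (fun n => ModMax (powSub I M n)) n) (Submodule.Quotient.mk ⟨m, hm⟩))
          rwa [LinearMap.id_apply, fiberAct_lof, fiberMul_mk] at this
        | add a _ b _ ha hb =>
          obtain ⟨ha, ha'⟩ := ha
          obtain ⟨hb, hb'⟩ := hb
          refine ⟨Submodule.add_mem _ ha hb, ?_⟩
          have := Submodule.add_mem _ ha' hb'
          rwa [← map_add, ← Submodule.Quotient.mk_add] at this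
      exact (key m hm').2

/-- If `I ^ (n + 1) M` needs at most `n + 1` generators, then `I ^ (n + 1) M = x I ^ n M` for some
`x ∈ I`. -/
theorem exists_powSub_eq_smul [IsNoetherian A M] [Infinite (ResidueField A)]
    {n : ℕ} (hn : Module.finrank (ResidueField A) (ModMax (powSub I M (n + 1))) ≤ n + 1) :
    ∃ x ∈ I, powSub I M (n + 1) = x • powSub I M n := by
  obtain ⟨_, ⟨x, rfl⟩, hx⟩ := exists_map_actPow_eq (E := FiberModule M I)
    (fiberForms_comm M (I := I)) n
    (LinearMap.range (DirectSum.lof (ResidueField A) ℕ (fun n => ModMax (powSub I M n)) 0))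
    (fun i => by rw [actPow_fiberForms]; infer_instance)
    (by
      rw [actPow_fiberForms, LinearMap.finrank_range_of_inj (DirectSum.of_injective _)]
      exact hn)
  rw [actPow_fiberForms, actPow_fiberForms] at hx
  refine ⟨x, x.2, le_antisymm ?_ (smul_powSub_le M x.2 n)⟩
  -- The equality holds modulo 𝔪I^(n+1)M; Nakayama lifts it.
  refine Submodule.le_of_le_smul_of_le_jacobson_bot (IsNoetherian.noetherian _)
    (maximalIdeal_le_jacobson ⊥) fun m hm => ?_
  have hmem : DirectSum.lof (ResidueField A) ℕ (fun n => ModMax (powSub I M n)) (n + 1)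
      (Submodule.Quotient.mk ⟨m, hm⟩) ∈ Submodule.map (fiberAct M x)
        (LinearMap.range (DirectSum.lof (ResidueField A) ℕ
          (fun n => ModMax (powSub I M n)) n)) := by
    rw [← hx]; exact LinearMap.mem_range_self _ _
  obtain ⟨_, ⟨e, rfl⟩, he⟩ := hmem
  obtain ⟨⟨d, hd⟩, rfl⟩ := Submodule.Quotient.mk_surjective _ e
  rw [fiberAct_lof, fiberMul_mk] at he
  have he' := DirectSum.of_injective _ he
  rw [eq_comm, Submodule.Quotient.eq] at he'
  have h1 : m - (x : A) • d ∈ maximalIdeal A • powSub I M (n + 1) := by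
    have := Submodule.mem_map_of_mem (f := (powSub I M (n + 1)).subtype) he'
    rwa [Submodule.map_smul'', Submodule.map_top, Submodule.range_subtype] at this
  rw [← add_sub_cancel ((x : A) • d) m]
  exact Submodule.add_mem_sup (Submodule.smul_mem_pointwise_smul _ _ _ hd) h1

end FiberModule

/-! ### Colengths and the existence of a reduction -/

section Colength

open IsLocalRing AssocGr
open scoped Pointwise

section General

variable {A : Type*} [CommRing A] {M : Type*} [AddCommGroup M] [Module A M]

theorem length_quotient_eq_add_of_le {P Q : Submodule A M} (h : P ≤ Q) :
    Module.length A (M ⧸ P) =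
      Module.length A (↥Q ⧸ P.submoduleOf Q) + Module.length A (M ⧸ Q) := by
  refine Module.length_eq_add_of_exact (P.submoduleOf Q |>.mapQ P Q.subtype le_rfl)
    (Submodule.factor h) ?_ (Submodule.factor_surjective h) ?_
  · rw [← LinearMap.ker_eq_bot, LinearMap.ker_eq_bot']
    intro q hq
    obtain ⟨q, rfl⟩ := Submodule.Quotient.mk_surjective _ q
    exact (Submodule.Quotient.mk_eq_zero _).2 ((Submodule.Quotient.mk_eq_zero P).1 hq)
  · rw [LinearMap.exact_iff]
    ext m
    obtain ⟨m, rfl⟩ := Submodule.Quotient.mk_surjective _ m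
    constructor
    · intro hm
      have hm' : m ∈ Q := (Submodule.Quotient.mk_eq_zero _).1 hm
      exact ⟨Submodule.Quotient.mk ⟨m, hm'⟩, rfl⟩
    · rintro ⟨q, hq⟩
      obtain ⟨q, rfl⟩ := Submodule.Quotient.mk_surjective _ q
      rw [← hq]
      exact (Submodule.Quotient.mk_eq_zero _).2 q.2

theorem length_quotient_ne_top_of_le {P Q : Submodule A M} (h : P ≤ Q)
    (hP : Module.length A (M ⧸ P) ≠ ⊤) : Module.length A (M ⧸ Q) ≠ ⊤ := by
  rw [length_quotient_eq_add_of_le h] at hP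
  exact fun hQ => hP (by rw [hQ, add_top])

/-- The length of `M / P`, as a natural number. -/
noncomputable def colength (P : Submodule A M) : ℕ := (Module.length A (M ⧸ P)).toNat

theorem coe_colength {P : Submodule A M} (hP : Module.length A (M ⧸ P) ≠ ⊤) :
    (colength P : ℕ∞) = Module.length A (M ⧸ P) := ENat.natCast_toNat hP

theorem colength_top : colength (⊤ : Submodule A M) = 0 := by
  rw [colength, Module.length_eq_zero, ENat.toNat_zero]

theorem colength_le {P Q : Submodule A M} (h : P ≤ Q) (hP : Module.length A (M ⧸ P) ≠ ⊤) :
    colength Q ≤ colength P := by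
  refine ENat.toNat_le_toNat ?_ hP
  rw [length_quotient_eq_add_of_le h]
  exact le_add_self

theorem colength_lt {P Q : Submodule A M} (h : P < Q) (hP : Module.length A (M ⧸ P) ≠ ⊤) :
    colength Q < colength P := by
  have hQ := length_quotient_ne_top_of_le h.le hP
  have h1 := length_quotient_eq_add_of_le h.le
  have hpos : 0 < Module.length A (↥Q ⧸ P.submoduleOf Q) := by
    rw [Module.length_pos_iff, Submodule.Quotient.nontrivial_iff, Ne, Submodule.submoduleOf,
      Submodule.comap_subtype_eq_top]
    exact h.not_ge
  rw [← Nat.cast_lt (α := ℕ∞), coe_colength hP, coe_colength hQ, h1]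
  calc Module.length A (M ⧸ Q) = 0 + Module.length A (M ⧸ Q) := (zero_add _).symm
    _ < _ := (ENat.add_lt_add_iff_right hQ).2 hpos

/-- Multiplication by `x` from `M / P` to `x M / x P`. -/
def smulQuotient (x : A) (P : Submodule A M) :
    (M ⧸ P) →ₗ[A] ↥(x • (⊤ : Submodule A M)) ⧸ (x • P).submoduleOf (x • (⊤ : Submodule A M)) :=
  Submodule.mapQ _ _ ((LinearMap.lsmul A M x).codRestrict _ fun m =>
    Submodule.smul_mem_pointwise_smul m x ⊤ trivial) fun m hm =>
      Submodule.smul_mem_pointwise_smul m x P hm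

theorem smulQuotient_surjective (x : A) (P : Submodule A M) :
    Function.Surjective (smulQuotient x P) := by
  intro q
  obtain ⟨⟨_, m, -, rfl⟩, rfl⟩ := Submodule.Quotient.mk_surjective _ q
  exact ⟨Submodule.Quotient.mk m, rfl⟩

theorem smulQuotient_injective {x : A} (hx : ∀ m : M, x • m = 0 → m = 0) (P : Submodule A M) :
    Function.Injective (smulQuotient x P) := by
  rw [← LinearMap.ker_eq_bot, LinearMap.ker_eq_bot']
  intro q hq
  obtain ⟨m, rfl⟩ := Submodule.Quotient.mk_surjective _ q
  obtain ⟨p, hp, hpm⟩ : x • m ∈ x • P :=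
    (Submodule.Quotient.mk_eq_zero ((x • P).submoduleOf (x • (⊤ : Submodule A M)))).1 hq
  refine (Submodule.Quotient.mk_eq_zero _).2 ?_
  have : x • (p - m) = 0 := by rw [smul_sub, sub_eq_zero]; exact hpm
  rwa [← sub_eq_zero.1 (hx _ this)]

theorem smul_le_smul_top (x : A) (P : Submodule A M) : x • P ≤ x • (⊤ : Submodule A M) :=
  Submodule.map_mono le_top

theorem length_quotient_smul_le (x : A) (P : Submodule A M) :
    Module.length A (M ⧸ x • P) ≤
      Module.length A (M ⧸ P) + Module.length A (M ⧸ x • (⊤ : Submodule A M)) := by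
  rw [length_quotient_eq_add_of_le (smul_le_smul_top x P)]
  gcongr
  exact Module.length_le_of_surjective _ (smulQuotient_surjective x P)

theorem length_quotient_smul_eq {x : A} (hx : ∀ m : M, x • m = 0 → m = 0) (P : Submodule A M) :
    Module.length A (M ⧸ x • P) =
      Module.length A (M ⧸ P) + Module.length A (M ⧸ x • (⊤ : Submodule A M)) := by
  rw [length_quotient_eq_add_of_le (smul_le_smul_top x P), (LinearEquiv.ofBijective _
    ⟨smulQuotient_injective hx P, smulQuotient_surjective x P⟩).length_eq]

theorem colength_smul_le {x : A} {P : Submodule A M} (hP : Module.length A (M ⧸ P) ≠ ⊤)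
    (hx : Module.length A (M ⧸ x • (⊤ : Submodule A M)) ≠ ⊤) :
    Module.length A (M ⧸ x • P) ≠ ⊤ ∧
      colength (x • P) ≤ colength P + colength (x • (⊤ : Submodule A M)) := by
  have h := length_quotient_smul_le x P
  rw [← coe_colength hP, ← coe_colength hx, ← Nat.cast_add] at h
  have hne := ne_top_of_le_ne_top (ENat.natCast_ne_top _) h
  rw [← coe_colength hne, Nat.cast_le] at h
  exact ⟨hne, h⟩

theorem colength_smul_eq {x : A} (hxm : ∀ m : M, x • m = 0 → m = 0) {P : Submodule A M}
    (hP : Module.length A (M ⧸ P) ≠ ⊤)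
    (hx : Module.length A (M ⧸ x • (⊤ : Submodule A M)) ≠ ⊤) :
    colength (x • P) = colength P + colength (x • (⊤ : Submodule A M)) := by
  have h := length_quotient_smul_eq hxm P
  rw [← coe_colength hP, ← coe_colength hx, ← Nat.cast_add,
    ← coe_colength (colength_smul_le hP hx).1, Nat.cast_inj] at h
  exact h

theorem powSub_succ (I : Ideal A) (n : ℕ) : powSub I M (n + 1) = I • powSub I M n := by
  rw [powSub, pow_succ', mul_smul]

theorem powSub_add (I : Ideal A) (i n : ℕ) : powSub I M (i + n) = I ^ i • powSub I M n := by
  rw [powSub, pow_add, mul_smul]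

theorem powSub_zero (I : Ideal A) : powSub I M 0 = ⊤ := by
  rw [powSub, pow_zero, Ideal.one_eq_top, Submodule.top_smul]

theorem powSub_anti (I : Ideal A) {i j : ℕ} (h : i ≤ j) : powSub I M j ≤ powSub I M i :=
  Submodule.smul_mono_left (Ideal.pow_le_pow_right h)

theorem powSub_eq_smul_of_le {I : Ideal A} {x : A} {r n : ℕ}
    (h : powSub I M (r + 1) = x • powSub I M r) (hn : r ≤ n) :
    powSub I M (n + 1) = x • powSub I M n := by
  induction n, hn using Nat.le_induction with
  | base => exact h
  | succ n _ ih =>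
    calc powSub I M (n + 1 + 1) = I • x • powSub I M n := by rw [powSub_succ, ih]
      _ = x • I • powSub I M n := (Submodule.map_smul'' _ _ _).symm
      _ = x • powSub I M (n + 1) := by rw [powSub_succ I n]

end General

section Local

variable {A : Type*} [CommRing A] [IsLocalRing A] {M : Type*} [AddCommGroup M] [Module A M]

theorem length_quotient_maximalIdeal_smul (N : Submodule A M) :
    Module.length A (M ⧸ maximalIdeal A • N) =
      Module.length (ResidueField A) (ModMax N) + Module.length A (M ⧸ N) := by
  rw [length_quotient_eq_add_of_le (Submodule.smul_le_right : maximalIdeal A • N ≤ N)]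
  congr 1
  have : (maximalIdeal A • N).submoduleOf N = maximalIdeal A • ⊤ := by
    rw [Submodule.submoduleOf, ← Submodule.map_injective_of_injective
      N.injective_subtype |>.eq_iff, Submodule.map_comap_subtype, Submodule.map_smul'',
      Submodule.map_top, Submodule.range_subtype]
    exact inf_eq_right.2 Submodule.smul_le_right
  rw [this]
  exact Module.length_eq_of_surjective residue_surjective

variable [IsNoetherian A M]

theorem colength_maximalIdeal_smul {N : Submodule A M} (hN : Module.length A (M ⧸ N) ≠ ⊤) :
    Module.length A (M ⧸ maximalIdeal A • N) ≠ ⊤ ∧ colength (maximalIdeal A • N) =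
      Module.finrank (ResidueField A) (ModMax N) + colength N := by
  have h := length_quotient_maximalIdeal_smul N
  rw [Module.length_eq_finrank, ← coe_colength hN, ← Nat.cast_add] at h
  have hne : Module.length A (M ⧸ maximalIdeal A • N) ≠ ⊤ := by
    rw [h]; exact ENat.natCast_ne_top _
  rw [← coe_colength hne, Nat.cast_inj] at h
  exact ⟨hne, h⟩

theorem length_quotient_maximalIdeal_pow_smul_ne_top (N : Submodule A M)
    (hN : Module.length A (M ⧸ N) ≠ ⊤) (n : ℕ) :
    Module.length A (M ⧸ maximalIdeal A ^ n • N) ≠ ⊤ := by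
  induction n with
  | zero => rwa [pow_zero, Ideal.one_eq_top, Submodule.top_smul]
  | succ n ih =>
    rw [pow_succ', mul_smul]
    exact (colength_maximalIdeal_smul ih).1

theorem maximalIdeal_smul_lt {N : Submodule A M} (hN : N ≠ ⊥) : maximalIdeal A • N < N := by
  refine lt_of_le_of_ne Submodule.smul_le_right fun h => hN ?_
  exact Submodule.eq_bot_of_le_smul_of_le_jacobson_bot _ _ (IsNoetherian.noetherian _) h.ge
    (maximalIdeal_le_jacobson ⊥)

/-- Passing from N to 𝔪N costs the minimal number of generators of N. By Nakayama, each of the `b`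
further multiplications by 𝔪 costs at least 1, because the module being multiplied is still nonzero.
-/
theorem finrank_add_le_colength {N : Submodule A M} (hN : Module.length A (M ⧸ N) ≠ ⊤) {b : ℕ}
    (hne : maximalIdeal A ^ b • N ≠ ⊥) :
    colength N + Module.finrank (ResidueField A) (ModMax N) + b ≤
      colength (maximalIdeal A ^ (b + 1) • N) := by
  induction b with
  | zero =>
    rw [zero_add, pow_one, (colength_maximalIdeal_smul hN).2, add_zero, add_comm]
  | succ b ih =>
    have hlt : maximalIdeal A ^ (b + 1 + 1) • N < maximalIdeal A ^ (b + 1) • N := by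
      rw [pow_succ' _ (b + 1), mul_smul]
      exact maximalIdeal_smul_lt hne
    have h1 := ih fun h => hne (by rw [pow_succ', mul_smul, h, Submodule.smul_bot])
    have h2 := colength_lt hlt (length_quotient_maximalIdeal_pow_smul_ne_top N hN _)
    omega

/-- If `M / I ^ n M` has finite length for all `n` and `I ^ K M ⊆ y M` for some `y ∈ I`, then
`I ^ (r + 1) M = x I ^ r M` for some `x ∈ I` and some `r`. -/
theorem exists_powSub_succ_eq_smul [Infinite (ResidueField A)] {I : Ideal A}
    (hI : I ≤ maximalIdeal A) (hfin : ∀ n, Module.length A (M ⧸ powSub I M n) ≠ ⊤)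
    {y : A} (hy : y ∈ I) {K : ℕ} (hK : powSub I M K ≤ y • (⊤ : Submodule A M)) :
    ∃ r, ∃ x ∈ I, powSub I M (r + 1) = x • powSub I M r := by
  by_contra hcon
  -- Without a reduction the numbers of generators grow at least linearly, hence the colengths
  -- quadratically.
  have hrank : ∀ n, n + 1 < Module.finrank (ResidueField A) (ModMax (powSub I M (n + 1))) := by
    intro n
    by_contra! hn
    exact hcon ⟨n, exists_powSub_eq_smul M hn⟩
  have hlow : ∀ n, n * (n + 1) ≤ 2 * colength (powSub I M (n + 1)) := by
    intro n
    induction n with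
    | zero => simp
    | succ n ih =>
      have h1 := (colength_maximalIdeal_smul (hfin (n + 1))).2
      have h2 : colength (maximalIdeal A • powSub I M (n + 1)) ≤
          colength (powSub I M (n + 1 + 1)) := by
        refine colength_le ?_ (hfin _)
        rw [powSub_succ]
        exact Submodule.smul_mono_left hI
      have := hrank n
      nlinarith
  have hytop := length_quotient_ne_top_of_le hK (hfin K)
  -- The opposing linear bound: I^nM contains y^nM, of colength at most n times that of yM.
  have hup : ∀ n, ∃ P : Submodule A M, P ≤ powSub I M n ∧ Module.length A (M ⧸ P) ≠ ⊤ ∧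
      colength P ≤ n * colength (y • (⊤ : Submodule A M)) := by
    intro n
    induction n with
    | zero =>
      refine ⟨⊤, (powSub_zero I).ge, ?_, ?_⟩
      · rw [Module.length_eq_zero]; exact ENat.zero_ne_top
      · rw [colength_top]; exact Nat.zero_le _
    | succ n ih =>
      obtain ⟨P, hP, hPfin, hPle⟩ := ih
      have h := colength_smul_le hPfin hytop
      refine ⟨y • P, (Submodule.map_mono hP).trans (smul_powSub_le M hy n), h.1, ?_⟩
      rw [add_mul, one_mul]
      exact h.2.trans (Nat.add_le_add_right hPle _)
  set C := colength (y • (⊤ : Submodule A M))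
  -- At this exponent the two bounds read (2C+1)(2C+2) ≤ 2C(2C+2), which is absurd.
  obtain ⟨P, hP, hPfin, hPle⟩ := hup (2 * C + 1 + 1)
  have h1 := hlow (2 * C + 1)
  have h2 := (colength_le hP hPfin).trans hPle
  nlinarith

end Local

end Colength

/-! ### Reduction number and Hilbert coefficients without I-torsion -/

section TorsionFree

open IsLocalRing AssocGr
open scoped Pointwise

theorem powSub_add_eq_pow_smul {A : Type*} [CommRing A] {M : Type*} [AddCommGroup M] [Module A M]
    {I : Ideal A} {x : A} {r : ℕ} (h : powSub I M (r + 1) = x • powSub I M r) (j : ℕ) :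
    powSub I M (r + j) = x ^ j • powSub I M r := by
  induction j with
  | zero => rw [pow_zero, one_smul, add_zero]
  | succ j ih =>
    rw [← add_assoc, powSub_eq_smul_of_le h (Nat.le_add_right r j), ih, pow_succ', mul_smul]

theorem forall_pow_smul_eq_zero {A : Type*} [CommRing A] {M : Type*} [AddCommGroup M]
    [Module A M] {I : Ideal A} (htf : ∀ u : M, (∀ a ∈ I, a • u = 0) → u = 0) (n : ℕ) (u : M)
    (hu : ∀ a ∈ I ^ n, a • u = 0) : u = 0 := by
  induction n generalizing u with
  | zero => rw [← one_smul A u]; exact hu 1 (by simp)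
  | succ n ih =>
    refine htf u fun a ha => ih _ fun c hc => ?_
    rw [smul_smul]
    exact hu _ (by rw [pow_succ]; exact Ideal.mul_mem_mul hc ha)

/-- An element `x` with `I ^ (r + 1) M = x I ^ r M` is regular on a module without elements
annihilated by `I`. -/
theorem smul_eq_zero_imp_of_powSub_eq {A : Type*} [CommRing A] {M : Type*} [AddCommGroup M]
    [Module A M] [IsNoetherian A M] {I : Ideal A} (htf : ∀ u : M, (∀ a ∈ I, a • u = 0) → u = 0)
    {x : A} {r : ℕ} (h : powSub I M (r + 1) = x • powSub I M r) (u : M) (hu : x • u = 0) :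
    u = 0 := by
  obtain ⟨j, hj⟩ := monotone_stabilizes_iff_noetherian.2 ‹IsNoetherian A M›
    ⟨fun j => LinearMap.ker (LinearMap.lsmul A M (x ^ j)), by
      refine monotone_nat_of_le_succ fun j m hm => ?_
      have hm' : x ^ j • m = 0 := hm
      change x ^ (j + 1) • m = 0
      rw [pow_succ', mul_smul, hm', smul_zero]⟩
  have hj' : ∀ w : M, x ^ (j + 1) • w = 0 → x ^ j • w = 0 := fun w hw => by
    have h' : LinearMap.ker (LinearMap.lsmul A M (x ^ j)) =
      LinearMap.ker (LinearMap.lsmul A M (x ^ (j + 1))) := hj (j + 1) (Nat.le_succ j)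
    exact h'.ge (show w ∈ LinearMap.ker (LinearMap.lsmul A M (x ^ (j + 1))) from hw)
  -- For a in I^(r+j), write a u = x^j w. Then x^(j+1) w = a x u = 0, and stability of the kernels
  -- gives x^j w = 0.
  refine forall_pow_smul_eq_zero htf (r + j) u fun a ha => ?_
  have hmem : a • u ∈ powSub I M (r + j) := Submodule.smul_mem_smul ha trivial
  rw [powSub_add_eq_pow_smul h] at hmem
  obtain ⟨w, -, hw⟩ := (Submodule.mem_smul_pointwise_iff_exists _ _ _).1 hmem
  rw [← hw]
  apply hj'
  rw [pow_succ', mul_smul, hw, smul_comm, hu, smul_zero]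

/-- The bound on the reduction number and the first Hilbert coefficient of a one-dimensional
module of positive depth: `e₀ = length (M / x M)` and `e₁ = e₀ r - length (M / I ^ r M)`. -/
theorem exists_reduction_bound {A : Type*} [CommRing A] [IsLocalRing A]
    [Infinite (ResidueField A)] {M : Type*} [AddCommGroup M] [Module A M] [IsNoetherian A M]
    {I : Ideal A} (hI : I ≤ maximalIdeal A)
    (hfin : ∀ n, Module.length A (M ⧸ powSub I M n) ≠ ⊤) (hne : ∀ n, powSub I M n ≠ ⊥)
    (htf : ∀ u : M, (∀ a ∈ I, a • u = 0) → u = 0)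
    (hred : ∃ r, ∃ x ∈ I, powSub I M (r + 1) = x • powSub I M r) {b : ℕ}
    (hb : I • (⊤ : Submodule A M) ≤ maximalIdeal A ^ (b + 1) • (⊤ : Submodule A M)) :
    ∃ r : ℕ, ∃ x ∈ I, ∃ e : ℕ, powSub I M (r + 1) = x • powSub I M r ∧
      (∀ u : M, x • u = 0 → u = 0) ∧
      (∀ j, colength (powSub I M (r + j)) = colength (powSub I M r) + j * e) ∧
      b + 1 + r ≤ e ∧ r * (b + 1) * 2 + r * r ≤ 2 * colength (powSub I M r) + r := by
  classical
  -- Taking the least `r` makes the generator count in `hrank` available in every degree up to `r`.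
  obtain ⟨x, hx, hxr⟩ := Nat.find_spec hred
  have hmin : ∀ {n}, n < Nat.find hred → ∀ x ∈ I, powSub I M (n + 1) ≠ x • powSub I M n :=
    fun hn x hx h => Nat.find_min hred hn ⟨x, hx, h⟩
  set r := Nat.find hred
  have hreg := smul_eq_zero_imp_of_powSub_eq htf hxr
  have hxtop : Module.length A (M ⧸ x • (⊤ : Submodule A M)) ≠ ⊤ := by
    refine length_quotient_ne_top_of_le ?_ (hfin (r + 1))
    rw [hxr]
    exact smul_le_smul_top x _
  set e := colength (x • (⊤ : Submodule A M))
  have hstep : ∀ n, colength (x • powSub I M n) = colength (powSub I M n) + e := fun n =>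
    colength_smul_eq hreg (hfin n) hxtop
  have hrank : ∀ n ≤ r, n < Module.finrank (ResidueField A) (ModMax (powSub I M n)) := by
    intro n hn
    rcases n with _ | n
    · have : Nontrivial (ModMax (powSub I M 0)) := by
        rw [Submodule.Quotient.nontrivial_iff]
        intro h
        have h0 := maximalIdeal_smul_lt (hne 0)
        apply_fun Submodule.map (powSub I M 0).subtype at h
        rw [Submodule.map_smul'', Submodule.map_top, Submodule.range_subtype] at h
        exact h0.ne h
      exact Module.finrank_pos
    · by_contra! hcon
      obtain ⟨y, hy, hyn⟩ := exists_powSub_eq_smul M hcon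
      exact hmin hn y hy hyn
  have hlow : ∀ n ≤ r, colength (powSub I M n) + n + 1 + b ≤ colength (powSub I M (n + 1)) := by
    intro n hn
    -- Multiplying the hypothesis `hb` by I^n gives this inclusion; the factor 𝔪^(b+1) accounts for
    -- the extra `b` in the length estimate.
    have hle : powSub I M (n + 1) ≤ maximalIdeal A ^ (b + 1) • powSub I M n := by
      calc powSub I M (n + 1) = I ^ n • (I • (⊤ : Submodule A M)) := by
            rw [powSub, pow_succ, mul_smul]
        _ ≤ I ^ n • (maximalIdeal A ^ (b + 1) • (⊤ : Submodule A M)) :=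
            smul_mono_right _ hb
        _ = _ := by rw [← mul_smul, ← mul_smul, mul_comm]
    have h1 := colength_le hle (hfin _)
    have h2 := finrank_add_le_colength (hfin n) (b := b) fun h => hne (b + n) (by
      rw [powSub_add, eq_bot_iff, ← h]
      exact Submodule.smul_mono_left (Ideal.pow_right_mono hI b))
    have := hrank n hn
    omega
  have hsum : ∀ n ≤ r, n * (b + 1) * 2 + n * n ≤ 2 * colength (powSub I M n) + n := by
    intro n
    induction n with
    | zero => simp
    | succ n ih =>
      intro hn
      have := ih (by omega)
      have := hlow n (by omega)
      nlinarith
  refine ⟨r, x, hx, e, hxr, hreg, ?_, ?_, hsum r le_rfl⟩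
  · intro j
    induction j with
    | zero => simp
    | succ j ih =>
      rw [← add_assoc, powSub_eq_smul_of_le hxr (Nat.le_add_right r j), hstep, ih]
      ring
  -- For r = 0, e is the colength of IM. For r > 0, I^rM strictly contains x I^(r-1)M, which adds
  -- one to the estimate in degree r - 1.
  · rcases Nat.eq_zero_or_pos r with h0 | hpos
    · have h1 := hlow 0 (by omega)
      have h2 := hstep 0
      have h3 : powSub I M 1 = x • powSub I M 0 := by rw [h0] at hxr; exact hxr
      rw [← h3] at h2
      simp only [zero_add] at h1
      omega
    · obtain ⟨n, hn⟩ := Nat.exists_eq_succ_of_ne_zero hpos.ne'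
      have h1 := hlow n (by omega)
      have h2 : colength (powSub I M (n + 1)) < colength (x • powSub I M n) :=
        colength_lt (lt_of_le_of_ne (smul_powSub_le M hx n) (Ne.symm (hmin (by omega) x hx)))
          (colength_smul_le (hfin n) hxtop).1
      rw [hstep] at h2
      omega

end TorsionFree

/-! ### Consequences of dimension one: finite colength, nonvanishing powers, parameters -/

section DimensionOne

open IsLocalRing AssocGr
open scoped Pointwise

variable {A : Type*} [CommRing A] [IsLocalRing A]
  {M : Type*} [AddCommGroup M] [Module A M] [Module.Finite A M] {I : Ideal A}

theorem length_quotient_powSub_ne_top [IsNoetherianRing A] (hI : I.radical = maximalIdeal A) (n : ℕ) :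
    Module.length A (M ⧸ powSub I M n) ≠ ⊤ := by
  obtain ⟨K, hK⟩ := I.exists_radical_pow_le_of_fg (IsNoetherian.noetherian _)
  rw [hI] at hK
  have h0 : Module.length A (M ⧸ (⊤ : Submodule A M)) ≠ ⊤ := by
    rw [Module.length_eq_zero]; exact ENat.zero_ne_top
  refine length_quotient_ne_top_of_le (Submodule.smul_mono_left ?_)
    (length_quotient_maximalIdeal_pow_smul_ne_top ⊤ h0 (K * n))
  rw [pow_mul]
  exact Ideal.pow_right_mono hK n

theorem not_subsingleton_support {A : Type*} [CommRing A] {M : Type*} [AddCommGroup M] [Module A M]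
    (hM : Module.supportDim A M = 1) :
    ¬ Subsingleton (Module.support A M) := fun h => by
  have := Order.krullDim_nonpos_of_subsingleton (α := Module.support A M)
  rw [← Module.supportDim, hM] at this
  exact absurd this (by decide)

/-- If I^nM = 0, every prime of the support contains I and so equals 𝔪, which forces dimension at
most 0. -/
theorem powSub_ne_bot (hM : Module.supportDim A M = 1) (hI : I.radical = maximalIdeal A) (n : ℕ) :
    powSub I M n ≠ ⊥ := fun h => not_subsingleton_support hM <| by
  have hall : ∀ p : Module.support A M, p.1.asIdeal = maximalIdeal A := fun p => by
    have hp := Module.mem_support_iff_of_finite.1 p.2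
    refine le_antisymm (le_maximalIdeal p.1.2.ne_top) ?_
    rw [← hI, p.1.2.radical_le_iff]
    refine p.1.2.le_of_pow_le (n := n) (le_trans ?_ hp)
    intro a ha
    rw [Module.mem_annihilator]
    intro m
    have : a • m ∈ powSub I M n := Submodule.smul_mem_smul ha trivial
    rwa [h, Submodule.mem_bot] at this
  exact ⟨fun p q => Subtype.ext (PrimeSpectrum.ext ((hall p).trans (hall q).symm))⟩

/-- A module of dimension one has a parameter in any `𝔪`-primary ideal. -/
theorem exists_powSub_le_smul_top [IsNoetherianRing A] (hM : Module.supportDim A M = 1)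
    (hI : I.radical = maximalIdeal A) :
    ∃ y ∈ I, ∃ K, powSub I M K ≤ y • (⊤ : Submodule A M) := by
  set J := Module.annihilator A M with hJ
  have hIle : ∀ p : Ideal A, p.IsPrime → I ≤ p → p = maximalIdeal A := fun p hp h =>
    le_antisymm (le_maximalIdeal hp.ne_top) (by rwa [← hI, hp.radical_le_iff])
  have hsupp : ∀ (p : Ideal A) (hp : p.IsPrime), J ≤ p →
      (⟨p, hp⟩ : PrimeSpectrum A) ∈ Module.support A M := fun p hp h =>
    Module.mem_support_iff_of_finite.2 h
  have hmax : maximalIdeal A ∉ J.minimalPrimes := fun hmin => not_subsingleton_support hM <| by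
    have hall : ∀ p : Module.support A M, p.1.asIdeal = maximalIdeal A := fun p => by
      have hp := Module.mem_support_iff_of_finite.1 p.2
      exact le_antisymm (le_maximalIdeal p.1.2.ne_top)
        (hmin.2 ⟨p.1.2, hp⟩ (le_maximalIdeal p.1.2.ne_top))
    exact ⟨fun p q => Subtype.ext (PrimeSpectrum.ext ((hall p).trans (hall q).symm))⟩
  -- Prime avoidance: I lies in no minimal prime of the annihilator, since the only prime containing
  -- I is 𝔪, which is not minimal.
  obtain ⟨y, hyI, hy⟩ : ∃ y ∈ I, ∀ p ∈ J.minimalPrimes, y ∉ p := by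
    by_contra! hcon
    obtain ⟨p, hp, hIp⟩ := (Ideal.subset_union_prime_finite
      (J.finite_minimalPrimes_of_isNoetherianRing A) (f := id) ⊥ ⊥
      (fun p hp _ _ => hp.1.1) (I := I)).1 (by
        intro y hy
        obtain ⟨p, hp, hyp⟩ := hcon y hy
        exact Set.mem_biUnion hp hyp)
    exact hmax (hIle p hp.1.1 hIp ▸ hp)
  refine ⟨y, hyI, ?_⟩
  -- A prime q ≠ 𝔪 over the annihilator and y would sit strictly between a minimal prime and 𝔪,
  -- giving a chain of length two in the support.
  have hrad : maximalIdeal A ≤ (J ⊔ Ideal.span {y}).radical := by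
    rw [Ideal.radical_eq_sInf]
    refine le_sInf fun q hq => ?_
    obtain ⟨hq, hqp⟩ := hq
    by_contra hqm
    have hJq : J ≤ q := le_sup_left.trans hq
    have hyq : y ∈ q := hq (Ideal.mem_sup_right (Ideal.mem_span_singleton_self y))
    obtain ⟨p, hp, hpq⟩ := Ideal.exists_minimalPrimes_le hJq
    have hlt1 : p < q := lt_of_le_of_ne hpq fun h => hy p hp (h ▸ hyq)
    have hlt2 : q < maximalIdeal A := (le_maximalIdeal hqp.ne_top).lt_of_not_ge hqm
    let s : LTSeries (Module.support A M) :=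
      { length := 2
        toFun := ![⟨⟨p, hp.1.1⟩, hsupp p hp.1.1 hp.1.2⟩, ⟨⟨q, hqp⟩, hsupp q hqp hJq⟩,
          ⟨⟨maximalIdeal A, inferInstance⟩, hsupp _ _ (hJq.trans hlt2.le)⟩]
        step := by
          intro i
          fin_cases i
          · exact hlt1
          · exact hlt2 }
    have hs := Order.LTSeries.length_le_krullDim s
    rw [← Module.supportDim, hM] at hs
    exact absurd (show (2 : WithBot ℕ∞) ≤ 1 from hs) (by decide)
  obtain ⟨K, hK⟩ := Ideal.exists_pow_le_of_le_radical_of_fg hrad (IsNoetherian.noetherian _)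
  refine ⟨K, ?_⟩
  have hIm : I ≤ maximalIdeal A := hI ▸ Ideal.le_radical
  refine (Submodule.smul_mono_left ((Ideal.pow_right_mono hIm K).trans hK)).trans ?_
  rw [Submodule.sup_smul, hJ, ← Submodule.annihilator_top, Submodule.annihilator_smul, bot_sup_eq,
    Submodule.ideal_span_singleton_smul]

end DimensionOne

/-! ### The I-torsion submodule L and the filtration L ∩ I^nM -/

section General

open IsLocalRing AssocGr
open scoped Pointwise

theorem map_mkQ_powSub {A : Type*} [CommRing A] {M : Type*} [AddCommGroup M] [Module A M]
    (I : Ideal A) (L : Submodule A M) (n : ℕ) :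
    (powSub I M n).map L.mkQ = powSub I (M ⧸ L) n := by
  rw [powSub, Submodule.map_smul'', Submodule.map_top, Submodule.range_mkQ]

theorem map_mkQ_smul {A : Type*} [CommRing A] {M : Type*} [AddCommGroup M] [Module A M]
    (L : Submodule A M) (x : A) (P : Submodule A M) : (x • P).map L.mkQ = x • P.map L.mkQ := by
  rw [← Submodule.ideal_span_singleton_smul, Submodule.map_smul'',
    Submodule.ideal_span_singleton_smul]

theorem length_quotient_map_mkQ {A : Type*} [CommRing A] {M : Type*} [AddCommGroup M] [Module A M]
    (L P : Submodule A M) : Module.length A ((M ⧸ L) ⧸ P.map L.mkQ) =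
      Module.length A (M ⧸ L ⊔ P) :=
  (Submodule.quotientQuotientEquivQuotientSup L P).length_eq

/-- If `L ∩ P = 0`, then `M / P` is longer than `(M / L) / (P + L / L)` by the length of `L`. -/
theorem length_quotient_eq_of_inf_eq_bot {A : Type*} [CommRing A] {M : Type*} [AddCommGroup M]
    [Module A M] {L P : Submodule A M} (h : L ⊓ P = ⊥) :
    Module.length A (M ⧸ P) =
      Module.length A (L ⧸ (⊥ : Submodule A L)) + Module.length A ((M ⧸ L) ⧸ P.map L.mkQ) := by
  rw [length_quotient_map_mkQ, length_quotient_eq_add_of_le (le_sup_right : P ≤ L ⊔ P)]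
  congr 1
  have e := (LinearMap.quotientInfEquivSupQuotient L P).length_eq
  refine e.symm.trans ?_
  rw [← Submodule.comap_inf, h, Submodule.comap_bot, Submodule.ker_subtype]

/-- The elements annihilated by a power of `I` form a finitely generated submodule `L`, annihilated
by some `I ^ n`, and `M / L` has no elements annihilated by `I`. -/
theorem exists_torsion_submodule {A : Type*} [CommRing A] {M : Type*} [AddCommGroup M]
    [Module A M] [IsNoetherian A M] (I : Ideal A) :
    ∃ (L : Submodule A M) (n : ℕ), (∀ u ∈ L, ∀ a ∈ I ^ n, a • u = 0) ∧
      ∀ u : M ⧸ L, (∀ a ∈ I, a • u = 0) → u = 0 := by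
  obtain ⟨n, hn⟩ := monotone_stabilizes_iff_noetherian.2 ‹IsNoetherian A M›
    ⟨fun n => Submodule.torsionBySet A M ((I ^ n : Ideal A) : Set A), fun i j hij =>
      Submodule.torsionBySet_le_torsionBySet_of_subset (Ideal.pow_le_pow_right hij)⟩
  have hn' : Submodule.torsionBySet A M ((I ^ n : Ideal A) : Set A) =
      Submodule.torsionBySet A M ((I ^ (n + 1) : Ideal A) : Set A) := hn (n + 1) (Nat.le_succ n)
  refine ⟨Submodule.torsionBySet A M ((I ^ n : Ideal A) : Set A), n, fun u hu a ha =>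
    (Submodule.mem_torsionBySet_iff _ _).1 hu ⟨a, ha⟩, fun u hu => ?_⟩
  obtain ⟨u, rfl⟩ := Submodule.Quotient.mk_surjective _ u
  rw [Submodule.Quotient.mk_eq_zero, hn', Submodule.mem_torsionBySet_iff]
  rintro ⟨a, ha⟩
  change a • u = 0
  rw [pow_succ] at ha
  induction ha using Submodule.mul_induction_on' with
  | mem_mul_mem c hc d hd =>
    have hdu := hu d hd
    rw [← Submodule.Quotient.mk_smul, Submodule.Quotient.mk_eq_zero] at hdu
    rw [mul_smul]
    exact (Submodule.mem_torsionBySet_iff _ _).1 hdu ⟨c, hc⟩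
  | add c _ d _ hc hd => rw [add_smul, hc, hd, add_zero]

variable {A : Type*} [CommRing A] {M : Type*} [AddCommGroup M] [Module A M]

theorem mem_of_smul_mem {L : Submodule A M} {x : A} (hx : ∀ u : M ⧸ L, x • u = 0 → u = 0) {m : M}
    (hm : x • m ∈ L) : m ∈ L := by
  rw [← Submodule.Quotient.mk_eq_zero]
  exact hx _ (by rw [← Submodule.Quotient.mk_smul, Submodule.Quotient.mk_eq_zero]; exact hm)

/-- An element of L ∩ I^(r+n)M is x^n w. Regularity of x on M/L puts w in L, where I^n acts as zero.
-/
theorem inf_powSub_eq_bot_of_reduction {I : Ideal A} {L : Submodule A M} {n : ℕ}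
    (hn : ∀ u ∈ L, ∀ a ∈ I ^ n, a • u = 0) {x : A} (hxI : x ∈ I)
    (hx : ∀ u : M ⧸ L, x • u = 0 → u = 0) {r : ℕ}
    (hr : powSub I M (r + 1) = x • powSub I M r) : L ⊓ powSub I M (r + n) = ⊥ := by
  rw [eq_bot_iff]
  rintro u ⟨huL, hu⟩
  rw [powSub_add_eq_pow_smul hr] at hu
  obtain ⟨w, -, rfl⟩ := (Submodule.mem_smul_pointwise_iff_exists _ _ _).1 hu
  have hw : ∀ j, x ^ j • w ∈ L → w ∈ L := by
    intro j
    induction j with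
    | zero => intro h; rwa [pow_zero, one_smul] at h
    | succ j ih => intro h; rw [pow_succ', mul_smul] at h; exact ih (mem_of_smul_mem hx h)
  exact hn w (hw n huL) _ (Ideal.pow_mem_pow hxI n)

variable [IsLocalRing A] [IsNoetherian A M]

/-- If the filtration `L ∩ I ^ n M` is stationary at a place beyond the reduction number of `M / L`,
then it is zero there. -/
theorem inf_powSub_eq_bot_of_le {I : Ideal A} (hI : I ≤ maximalIdeal A) {L : Submodule A M} {x : A}
    (hxI : x ∈ I) (hx : ∀ u : M ⧸ L, x • u = 0 → u = 0) {r i : ℕ} (hri : r ≤ i)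
    (hr : powSub I (M ⧸ L) (r + 1) = x • powSub I (M ⧸ L) r)
    (h : L ⊓ powSub I M (i + 1) ≤ powSub I M (i + 2)) : L ⊓ powSub I M (i + 1) = ⊥ := by
  -- Lifting the equality from M/L leaves an error in L ∩ I^(i+1)M, which by hypothesis lies in I ·
  -- I^(i+1)M; Nakayama removes it.
  have hi : powSub I M (i + 1) = x • powSub I M i := by
    refine le_antisymm ?_ (smul_powSub_le M hxI i)
    refine Submodule.le_of_le_smul_of_le_jacobson_bot (IsNoetherian.noetherian _)
      (hI.trans (maximalIdeal_le_jacobson ⊥)) fun m hm => ?_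
    have hm' : L.mkQ m ∈ (x • powSub I M i).map L.mkQ := by
      rw [map_mkQ_smul, map_mkQ_powSub, ← powSub_eq_smul_of_le hr hri, ← map_mkQ_powSub]
      exact Submodule.mem_map_of_mem hm
    obtain ⟨w, hw, hwm⟩ := hm'
    have h1 : m - w ∈ L := (Submodule.Quotient.eq L).1 hwm.symm
    have h2 : m - w ∈ powSub I M (i + 1) := Submodule.sub_mem _ hm (smul_powSub_le M hxI i hw)
    rw [← add_sub_cancel w m, ← powSub_succ]
    exact Submodule.add_mem_sup hw (h ⟨h1, h2⟩)
  -- Now L ∩ I^(i+1)M lies in x I^(i+1)M, and regularity of x on M/L turns this into containment in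
  -- x(L ∩ I^(i+1)M).
  refine Submodule.eq_bot_of_le_smul_of_le_jacobson_bot (maximalIdeal A) _
    (IsNoetherian.noetherian _) (fun u hu => ?_) (maximalIdeal_le_jacobson ⊥)
  have hu2 := h hu
  rw [powSub_eq_smul_of_le hi (Nat.le_succ i)] at hu2
  obtain ⟨w, hw, rfl⟩ := (Submodule.mem_smul_pointwise_iff_exists _ _ _).1 hu2
  exact Submodule.smul_mem_smul (hI hxI) ⟨mem_of_smul_mem hx hu.1, hw⟩

/-- `L ∩ I ^ n M = 0` for all `n` larger than the sum of the reduction number of `M / L` and the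
length of `L`. -/
theorem inf_powSub_eq_bot_of_lt {I : Ideal A} (hI : I ≤ maximalIdeal A) {L : Submodule A M}
    (hL : Module.length A (L ⧸ (⊥ : Submodule A L)) ≠ ⊤) {x : A}
    (hxI : x ∈ I) (hx : ∀ u : M ⧸ L, x • u = 0 → u = 0) {r n : ℕ}
    (hr : powSub I (M ⧸ L) (r + 1) = x • powSub I (M ⧸ L) r)
    (hn : r + colength (⊥ : Submodule A L) < n) : L ⊓ powSub I M n = ⊥ := by
  by_contra hne
  -- As long as the filtration is nonzero beyond `r` it drops strictly, so the colength in L grows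
  -- by one per step until it exceeds ℓ(L).
  have hlow : ∀ i, r + i ≤ n →
      i ≤ colength ((powSub I M (r + i + 1)).submoduleOf L) := by
    intro i
    induction i with
    | zero => exact fun _ => Nat.zero_le _
    | succ i ih =>
      intro hi
      refine Nat.succ_le_of_lt ((ih (by omega)).trans_lt (colength_lt (lt_of_le_not_ge
        (Submodule.comap_mono (powSub_anti I (by omega))) fun hle => hne ?_)
        (length_quotient_ne_top_of_le bot_le hL)))
      rw [eq_bot_iff]
      refine (inf_le_inf_left L (powSub_anti I (show r + i + 1 ≤ n by omega))).trans (le_of_eq ?_)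
      exact inf_powSub_eq_bot_of_le hI hxI hx (Nat.le_add_right r i) hr fun u hu =>
        hle (show (⟨u, hu.1⟩ : L) ∈ _ from hu.2)
  have h1 := hlow (n - r) (by omega)
  have h2 := h1.trans (colength_le (bot_le : ⊥ ≤ _) hL)
  omega

end General

/-! ### The bound on β for a module of dimension one -/

section Main

open IsLocalRing AssocGr
open scoped Pointwise

/-- For a module of dimension one there are `x ∈ I` and `β` with `I ^ (n + 1) M = x I ^ n M` for
`n ≥ β` and `(I ^ (n + 2) M : x) ∩ I ^ n M = I ^ (n + 1) M` for `n > β`, where `β` is bounded in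
terms of the Hilbert coefficients. -/
theorem exists_regularity_bound {A : Type*} [CommRing A] [IsLocalRing A] [IsNoetherianRing A]
    [Infinite (ResidueField A)] {M : Type*} [AddCommGroup M] [Module A M] [Module.Finite A M]
    (hM : Module.supportDim A M = 1) {I : Ideal A} (hI : I.radical = maximalIdeal A) {b : ℕ}
    (hb : I • (⊤ : Submodule A M) ≤ maximalIdeal A ^ (b + 1) • (⊤ : Submodule A M)) :
    ∃ β : ℕ, ∃ x ∈ I, ∃ (e₀ : ℕ) (e₁ : ℤ),
      (∀ᶠ n : ℕ in Filter.atTop, (colength (powSub I M (n + 1)) : ℤ) = e₀ * (n + 1) - e₁) ∧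
      (∀ n, β ≤ n → powSub I M (n + 1) = x • powSub I M n) ∧
      (∀ n, β < n → ∀ m ∈ powSub I M n, x • m ∈ powSub I M (n + 2) → m ∈ powSub I M (n + 1)) ∧
      b + 1 ≤ e₀ ∧ 2 * ((β : ℤ) + e₁ + 1) ≤ ((e₀ : ℤ) - b + 1) * (e₀ - b) := by
  have hIm : I ≤ maximalIdeal A := hI ▸ Ideal.le_radical
  obtain ⟨y, hy, K, hK⟩ := exists_powSub_le_smul_top hM hI
  -- This reduction of M carries no bound on `s`. It serves to show that L misses deep powers, hence
  -- that L has finite length and that the colengths for M and M/L eventually differ by ℓ(L).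
  obtain ⟨s, z, hz, hzs⟩ := exists_powSub_succ_eq_smul hIm (length_quotient_powSub_ne_top hI) hy hK
  obtain ⟨L, t, hLt, htf⟩ := exists_torsion_submodule (M := M) I
  have hzs' : powSub I (M ⧸ L) (s + 1) = z • powSub I (M ⧸ L) s := by
    rw [← map_mkQ_powSub, hzs, map_mkQ_smul, map_mkQ_powSub]
  have hzreg := smul_eq_zero_imp_of_powSub_eq htf hzs'
  have hbot := inf_powSub_eq_bot_of_reduction hLt hz hzreg hzs
  have hbig : ∀ n, s + t ≤ n → Module.length A (M ⧸ powSub I M n) =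
      Module.length A (L ⧸ (⊥ : Submodule A L)) +
        Module.length A ((M ⧸ L) ⧸ powSub I (M ⧸ L) n) := by
    intro n hn
    rw [← map_mkQ_powSub]
    refine length_quotient_eq_of_inf_eq_bot ?_
    rw [eq_bot_iff, ← hbot]
    exact inf_le_inf_left L (powSub_anti I hn)
  have hL : Module.length A (L ⧸ (⊥ : Submodule A L)) ≠ ⊤ := fun h => by
    have := hbig (s + t) le_rfl
    rw [h, top_add] at this
    exact length_quotient_powSub_ne_top hI _ this
  have hfin := length_quotient_powSub_ne_top (M := M ⧸ L) hI
  have hcol : ∀ n, s + t ≤ n → colength (powSub I M n) =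
      colength (⊥ : Submodule A L) + colength (powSub I (M ⧸ L) n) := by
    intro n hn
    have := hbig n hn
    rw [← coe_colength (length_quotient_powSub_ne_top hI n), ← coe_colength hL,
      ← coe_colength (hfin n)] at this
    exact_mod_cast this
  obtain ⟨r, x, hx, e, hr, hreg, hhilb, he, hr2⟩ := exists_reduction_bound (M := M ⧸ L) hIm hfin
    (fun n h => by
      have hle : powSub I M n ≤ L := by
        rw [← map_mkQ_powSub, ← LinearMap.le_ker_iff_map, Submodule.ker_mkQ] at h
        exact h
      refine powSub_ne_bot hM hI (t + n) ?_
      rw [powSub_add, eq_bot_iff, Submodule.smul_le]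
      intro a ha m hm
      exact (Submodule.mem_bot A).2 (hLt m (hle hm) a ha))
    htf ⟨s, z, hz, hzs'⟩ (b := b) (by
      have := Submodule.map_mono (f := L.mkQ) hb
      rwa [Submodule.map_smul'', Submodule.map_smul'', Submodule.map_top,
        Submodule.range_mkQ] at this)
  have hzero : ∀ n, r + colength (⊥ : Submodule A L) < n → L ⊓ powSub I M n = ⊥ := fun n hn =>
    inf_powSub_eq_bot_of_lt hIm hL hx hreg hr hn
  have hsurj : ∀ n, r + colength (⊥ : Submodule A L) ≤ n →
      powSub I M (n + 1) = x • powSub I M n := by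
    intro n hn
    refine le_antisymm (fun m hm => ?_) (smul_powSub_le M hx n)
    have hm' : L.mkQ m ∈ (x • powSub I M n).map L.mkQ := by
      rw [map_mkQ_smul, map_mkQ_powSub, ← powSub_eq_smul_of_le hr (by omega), ← map_mkQ_powSub]
      exact Submodule.mem_map_of_mem hm
    obtain ⟨w, hw, hwm⟩ := hm'
    have h1 : m - w ∈ L ⊓ powSub I M (n + 1) :=
      ⟨(Submodule.Quotient.eq L).1 hwm.symm, Submodule.sub_mem _ hm (smul_powSub_le M hx n hw)⟩
    rw [hzero (n + 1) (by omega), Submodule.mem_bot, sub_eq_zero] at h1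
    rwa [h1]
  -- The length of L is added in β and subtracted in e₁, so it disappears from the final inequality.
  refine ⟨r + colength (⊥ : Submodule A L), x, hx, e,
    e * r - colength (powSub I (M ⧸ L) r) - colength (⊥ : Submodule A L), ?_, hsurj, ?_, by omega, ?_⟩
  · filter_upwards [Filter.eventually_ge_atTop (s + t + r)] with n hn
    rw [hcol (n + 1) (by omega)]
    obtain ⟨j, hj⟩ := Nat.exists_eq_add_of_le (show r ≤ n + 1 by omega)
    have hj' : (n : ℤ) + 1 = r + j := by exact_mod_cast hj
    rw [hj, hhilb j, hj']
    push_cast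
    ring
  · intro n hn m hm hxm
    rw [hsurj (n + 1) (by omega)] at hxm
    obtain ⟨w, hw, hwm⟩ := (Submodule.mem_smul_pointwise_iff_exists _ _ _).1 hxm
    have h0 : m - w ∈ L ⊓ powSub I M n := by
      refine ⟨mem_of_smul_mem hreg ?_, Submodule.sub_mem _ hm (powSub_anti I (Nat.le_succ n) hw)⟩
      rw [smul_sub, hwm, sub_self]
      exact L.zero_mem
    rw [hzero n hn, Submodule.mem_bot, sub_eq_zero] at h0
    rwa [h0]
  · have hr2' : (r : ℤ) * (b + 1) * 2 + r * r ≤ 2 * colength (powSub I (M ⧸ L) r) + r := by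
      exact_mod_cast hr2
    have he' : (b : ℤ) + 1 + r ≤ e := by exact_mod_cast he
    push_cast
    -- With t = e - b - r - 1 ≥ 0, the worst case of the lower bound leaves t² + 3t ≥ 0.
    nlinarith [mul_nonneg (sub_nonneg.2 he') (sub_nonneg.2 he')]

end Main

/-! ### Vanishing of graded Čech cohomology in degrees 0 and 1 -/

section CechVanishing

open GradedCech

theorem LocalizedModule.liftOfLE_mk {R : Type*} [CommRing R] {E : Type*} [AddCommGroup E]
    [Module R E] {S T : Submonoid R} (h : S ≤ T) (m : E) (t : S) :
    LocalizedModule.liftOfLE S T h (LocalizedModule.mk m t) =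
      LocalizedModule.mk (S := T) m ⟨t, h t.2⟩ := by
  rw [LocalizedModule.liftOfLE, IsLocalizedModule.mk_eq_mk', IsLocalizedModule.mk_eq_mk',
    IsLocalizedModule.liftOfLE_mk']

variable {R : Type*} [CommRing R] {𝒜 : ℕ → AddSubgroup R} {E : Type*} [AddCommGroup E]
  [Module R E] {ℳ : ℕ → AddSubgroup E}

/-- The properties of a graded module over a graded ring that are used to compute its Čech
cohomology. -/
structure IsGradedAction (𝒜 : ℕ → AddSubgroup R) (ℳ : ℕ → AddSubgroup E) : Prop where
  one_mem : 1 ∈ 𝒜 0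
  mul_mem : ∀ {i j a b}, a ∈ 𝒜 i → b ∈ 𝒜 j → a * b ∈ 𝒜 (i + j)
  smul_mem : ∀ {i j a m}, a ∈ 𝒜 i → m ∈ ℳ j → a • m ∈ ℳ (i + j)
  eq_zero : ∀ {i j a}, a ∈ 𝒜 i → a ∈ 𝒜 j → i ≠ j → a = 0
  exists_component : ∀ (e : E) (k : ℕ), ∃ e' ∈ ℳ k, ∀ {j : ℕ} {a : R} {m : E}, a ∈ 𝒜 j →
    m ∈ ℳ (j + k) → a • e = m → a • e' = m

theorem IsGradedAction.pow_mem (h : IsGradedAction 𝒜 ℳ) {a : R} (ha : a ∈ 𝒜 1) (n : ℕ) :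
    a ^ n ∈ 𝒜 n := by
  induction n with
  | zero => rw [pow_zero]; exact h.one_mem
  | succ n ih => rw [pow_succ]; exact h.mul_mem ih ha

theorem exists_pow_smul_eq {β : ℕ} {z : R}
    (hs : ∀ n, β ≤ n → ∀ m ∈ ℳ (n + 1), ∃ m' ∈ ℳ n, m = z • m') {n : ℕ} (hn : β ≤ n) (P : ℕ) :
    ∀ m ∈ ℳ (n + P), ∃ m' ∈ ℳ n, m = z ^ P • m' := by
  induction P with
  | zero => exact fun m hm => ⟨m, hm, by rw [pow_zero, one_smul]⟩
  | succ P ih =>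
    intro m hm
    obtain ⟨m₁, hm₁, rfl⟩ := hs (n + P) (by omega) m hm
    obtain ⟨m₂, hm₂, rfl⟩ := ih m₁ hm₁
    exact ⟨m₂, hm₂, by rw [pow_succ', mul_smul]⟩

theorem eq_zero_of_pow_smul (h : IsGradedAction 𝒜 ℳ) {β : ℕ} {z : R} (hz : z ∈ 𝒜 1)
    (hi : ∀ n, β < n → ∀ m ∈ ℳ n, z • m = 0 → m = 0) {n : ℕ} (hn : β < n) {m : E} (hm : m ∈ ℳ n)
    (P : ℕ) (hP : z ^ P • m = 0) : m = 0 := by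
  induction P with
  | zero => rwa [pow_zero, one_smul] at hP
  | succ P ih =>
    rw [pow_succ', mul_smul] at hP
    exact ih (hi _ (by omega) _ (h.smul_mem (h.pow_mem hz P) hm) hP)

variable {s : ℕ} {x : Fin s → R}

/-- Lets the single element z stand in for any system of generators x of the irrelevant ideal, so
that vanishing holds for all of them. -/
theorem exists_pow_mem_span (hx : Ideal.span (Set.range x) = irrelevant 𝒜) {z : R}
    (hz : z ∈ 𝒜 1) (N : ℕ) : ∃ (P : ℕ) (a : Fin s → R), ∑ i, a i * x i ^ N = z ^ P := by
  have hz' : z ∈ Ideal.span (Set.range x) := by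
    rw [hx]
    exact Ideal.subset_span (Set.mem_iUnion.2 ⟨0, hz⟩)
  have hle : Ideal.span (Set.range x) ≤ (Ideal.span (Set.range fun i => x i ^ N)).radical := by
    rw [Ideal.span_le]
    rintro _ ⟨i, rfl⟩
    exact ⟨N, Ideal.subset_span ⟨i, rfl⟩⟩
  obtain ⟨P, hP⟩ := hle hz'
  obtain ⟨a, ha⟩ := Ideal.mem_span_range_iff_exists_fun.1 hP
  exact ⟨P, a, ha⟩

theorem eq_zero_of_forall_pow_smul (h : IsGradedAction 𝒜 ℳ)
    (hx : Ideal.span (Set.range x) = irrelevant 𝒜) {β : ℕ} {z : R} (hz : z ∈ 𝒜 1)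
    (hi : ∀ n, β < n → ∀ m ∈ ℳ n, z • m = 0 → m = 0) {n : ℕ} (hn : β < n) {m : E} (hm : m ∈ ℳ n)
    {N : ℕ} (hN : ∀ i, x i ^ N • m = 0) : m = 0 := by
  obtain ⟨P, a, ha⟩ := exists_pow_mem_span hx hz N
  refine eq_zero_of_pow_smul h hz hi hn hm P ?_
  rw [← ha, Finset.sum_smul]
  exact Finset.sum_eq_zero fun i _ => by rw [mul_smul, hN, smul_zero]

/-- Compatible fractions `m i / x i ^ N` of degree `n` come from an element of degree `n`. -/
theorem exists_eq_pow_smul (h : IsGradedAction 𝒜 ℳ) (hx1 : ∀ i, x i ∈ 𝒜 1)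
    (hx : Ideal.span (Set.range x) = irrelevant 𝒜) {β : ℕ} {z : R} (hz : z ∈ 𝒜 1)
    (hs : ∀ n, β ≤ n → ∀ m ∈ ℳ (n + 1), ∃ m' ∈ ℳ n, m = z • m')
    (hi : ∀ n, β < n → ∀ m ∈ ℳ n, z • m = 0 → m = 0) {n : ℕ} (hn : β ≤ n) {N : ℕ} (hN : 0 < N)
    {m : Fin s → E} (hm : ∀ i, m i ∈ ℳ (N + n))
    (hcomp : ∀ i j, x i ^ N • m j = x j ^ N • m i) :
    ∃ b ∈ ℳ n, ∀ i, m i = x i ^ N • b := by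
  obtain ⟨P, a, ha⟩ := exists_pow_mem_span hx hz N
  -- The coefficients `a i` need not be homogeneous, so the glued sum is replaced by its component
  -- of degree `n + P`.
  obtain ⟨e, he, hemul⟩ := h.exists_component (∑ i, a i • m i) (n + P)
  have key : ∀ j, x j ^ N • e = z ^ P • m j := fun j => by
    refine hemul (h.pow_mem (hx1 j) N) ?_ ?_
    · rw [← add_assoc, add_comm (N + n)]
      exact h.smul_mem (h.pow_mem hz P) (hm j)
    · rw [← ha, Finset.smul_sum, Finset.sum_smul]
      refine Finset.sum_congr rfl fun i _ => ?_
      rw [smul_comm, hcomp j i, mul_smul]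
  obtain ⟨b, hb, rfl⟩ := exists_pow_smul_eq hs hn P e he
  refine ⟨b, hb, fun j => ?_⟩
  rw [← sub_eq_zero]
  -- Injectivity of z is known only above β; `N > 0` covers the boundary case `n = β`.
  refine eq_zero_of_pow_smul h hz hi (show β < N + n by omega)
    (AddSubgroup.sub_mem _ (hm j) (h.smul_mem (h.pow_mem (hx1 j) N) hb)) P ?_
  rw [smul_sub, ← key, smul_comm, sub_self]

theorem subsingleton_cechH {n : ℤ} {p : ℕ}
    (h : cocycles 𝒜 ℳ x n p ≤ coboundaries 𝒜 ℳ x n p) : Subsingleton (CechH 𝒜 ℳ x n p) := by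
  rw [CechH, AddSubgroup.addSubgroupOf_eq_top.2 h]
  exact QuotientAddGroup.subsingleton_quotient_top

theorem LocalizedModule.mk_add_mk_self {S : Submonoid R} (m m' : E) (t : S) :
    LocalizedModule.mk m t + LocalizedModule.mk m' t = LocalizedModule.mk (m + m') t := by
  rw [LocalizedModule.mk_add_mk, ← smul_add, LocalizedModule.mk_cancel_common_left]

/-- Elements of degree `n` of the localization at the powers of an element of degree one. -/
theorem exists_eq_mk_pow (h : IsGradedAction 𝒜 ℳ) {S : Submonoid R} {y : R} (hy : y ∈ 𝒜 1)
    (hyS : y ∈ S) (hS : ∀ t ∈ S, ∃ N, t = y ^ N) {n : ℕ}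
    {w : LocalizedModule S E} (hw : w ∈ locDeg 𝒜 ℳ S n) :
    ∃ N₀, ∀ N, N₀ ≤ N →
      ∃ m ∈ ℳ (N + n), w = LocalizedModule.mk m (⟨y ^ N, S.pow_mem hyS N⟩ : S) := by
  induction hw using AddSubgroup.closure_induction with
  | mem w hw =>
    obtain ⟨j, k, m, ⟨t, htS⟩, hm, ht, hjk, rfl⟩ := hw
    obtain ⟨N₀, rfl⟩ := hS t htS
    refine ⟨N₀, fun N hN => ?_⟩
    by_cases hk : k = N₀
    · subst hk
      refine ⟨y ^ (N - k) • m, ?_, ?_⟩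
      · rw [show N + n = N - k + j by omega]
        exact h.smul_mem (h.pow_mem hy _) hm
      · rw [← LocalizedModule.mk_cancel_common_left ⟨y ^ (N - k), S.pow_mem hyS _⟩]
        congr 1
        exact Subtype.ext (pow_sub_mul_pow y hN)
    -- A denominator lying in two different degrees is zero, and then the localization vanishes.
    · have h0 : y ^ N₀ = 0 := h.eq_zero ht (h.pow_mem hy N₀) hk
      have := LocalizedModule.subsingleton (M := E) (h0 ▸ htS)
      exact ⟨0, AddSubgroup.zero_mem _, Subsingleton.elim _ _⟩
  | zero => exact ⟨0, fun N _ => ⟨0, AddSubgroup.zero_mem _, (LocalizedModule.zero_mk _).symm⟩⟩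
  | add v w _ _ hv hw =>
    obtain ⟨N₁, h₁⟩ := hv
    obtain ⟨N₂, h₂⟩ := hw
    refine ⟨max N₁ N₂, fun N hN => ?_⟩
    obtain ⟨m₁, hm₁, rfl⟩ := h₁ N ((le_max_left _ _).trans hN)
    obtain ⟨m₂, hm₂, rfl⟩ := h₂ N ((le_max_right _ _).trans hN)
    exact ⟨m₁ + m₂, AddSubgroup.add_mem _ hm₁ hm₂, LocalizedModule.mk_add_mk_self _ _ _⟩
  | neg w _ hw =>
    obtain ⟨N₁, h₁⟩ := hw
    refine ⟨N₁, fun N hN => ?_⟩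
    obtain ⟨m, hm, rfl⟩ := h₁ N hN
    exact ⟨-m, AddSubgroup.neg_mem _ hm, LocalizedModule.mk_neg.symm⟩

/-- Elements of degree `n` of the localization at a trivial submonoid. -/
theorem exists_eq_mk_one (h : IsGradedAction 𝒜 ℳ) {S : Submonoid R} (hS : ∀ t ∈ S, t = 1) {n : ℕ}
    {w : LocalizedModule S E} (hw : w ∈ locDeg 𝒜 ℳ S n) :
    ∃ m ∈ ℳ n, w = LocalizedModule.mk m 1 := by
  induction hw using AddSubgroup.closure_induction with
  | mem w hw =>
    obtain ⟨j, k, m, ⟨t, htS⟩, hm, ht, hjk, rfl⟩ := hw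
    obtain rfl := hS t htS
    by_cases hk : k = 0
    · subst hk
      obtain rfl : n = j := by omega
      exact ⟨m, hm, rfl⟩
    · have h0 := h.eq_zero ht h.one_mem hk
      have := LocalizedModule.subsingleton (M := E) (S := S) (h0 ▸ htS)
      exact ⟨0, AddSubgroup.zero_mem _, Subsingleton.elim _ _⟩
  | zero => exact ⟨0, AddSubgroup.zero_mem _, (LocalizedModule.zero_mk _).symm⟩
  | add v w _ _ hv hw =>
    obtain ⟨m₁, hm₁, rfl⟩ := hv
    obtain ⟨m₂, hm₂, rfl⟩ := hw
    exact ⟨m₁ + m₂, AddSubgroup.add_mem _ hm₁ hm₂, LocalizedModule.mk_add_mk_self _ _ _⟩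
  | neg w _ hw =>
    obtain ⟨m, hm, rfl⟩ := hw
    exact ⟨-m, AddSubgroup.neg_mem _ hm, LocalizedModule.mk_neg.symm⟩

theorem exists_eq_pow_of_mem_cechSet (α : Fin 1 → Fin s) {t : R} (ht : t ∈ cechSet x α) :
    ∃ N, t = x (α 0) ^ N := by
  rw [cechSet, Set.range_unique, Submonoid.mem_closure_singleton] at ht
  obtain ⟨N, hN⟩ := ht
  exact ⟨N, hN.symm⟩

theorem exists_dvd_pow_of_mem_cechSet (γ : Fin 2 → Fin s) {t : R} (ht : t ∈ cechSet x γ) :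
    ∃ K, t ∣ (x (γ 0) * x (γ 1)) ^ K := by
  induction ht using Submonoid.closure_induction with
  | mem t ht =>
    obtain ⟨l, rfl⟩ := ht
    refine ⟨1, ?_⟩
    rw [pow_one]
    fin_cases l
    · exact dvd_mul_right _ _
    · exact dvd_mul_left _ _
  | one => exact ⟨0, one_dvd _⟩
  | mul t t' _ _ h h' =>
    obtain ⟨K, h⟩ := h
    obtain ⟨K', h'⟩ := h'
    exact ⟨K + K', by rw [pow_add]; exact mul_dvd_mul h h'⟩

theorem mem_cechSet {p : ℕ} (α : Fin p → Fin s) (l : Fin p) : x (α l) ∈ cechSet x α :=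
  Submonoid.subset_closure ⟨l, rfl⟩

theorem cechD_zero_apply {c : Cochain E x 0} {m : E} (hc : c Fin.elim0 = LocalizedModule.mk m 1)
    (α : Fin 1 → Fin s) : cechD E x 0 c α = LocalizedModule.mk m 1 := by
  have key : ∀ (α₀ : Fin 0 → Fin s) (hle : cechSet x α₀ ≤ cechSet x α),
      LocalizedModule.liftOfLE (M := E) _ _ hle (c α₀) = LocalizedModule.mk m 1 := by
    intro α₀ hle
    obtain rfl : α₀ = Fin.elim0 := Subsingleton.elim _ _
    rw [hc, LocalizedModule.liftOfLE_mk]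
    rfl
  simp only [cechD, LinearMap.pi_apply, LinearMap.sum_apply, LinearMap.smul_apply,
    LinearMap.comp_apply, LinearMap.proj_apply]
  rw [Fin.sum_univ_one]
  simp only [key, Fin.val_zero, pow_zero, one_smul]

theorem subsingleton_cechH_zero (h : IsGradedAction 𝒜 ℳ)
    (hx : Ideal.span (Set.range x) = irrelevant 𝒜) {β : ℕ} {z : R} (hz : z ∈ 𝒜 1)
    (hi : ∀ n, β < n → ∀ m ∈ ℳ n, z • m = 0 → m = 0) {n : ℕ} (hn : β < n) :
    Subsingleton (CechH 𝒜 ℳ x n 0) := by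
  refine subsingleton_cechH ?_
  rintro c ⟨hdeg, hker⟩
  have hker' : cechD E x 0 c = 0 := hker
  have hS : ∀ t ∈ cechSet x (Fin.elim0 : Fin 0 → Fin s), t = 1 := fun t ht => by
    rwa [cechSet, Set.range_eq_empty, Submonoid.closure_empty, Submonoid.mem_bot] at ht
  obtain ⟨m, hm, hc⟩ := exists_eq_mk_one h hS (hdeg Fin.elim0 trivial)
  have hpow : ∀ i, ∃ N, x i ^ N • m = 0 := fun i => by
    have h0 := cechD_zero_apply hc fun _ => i
    rw [hker', Pi.zero_apply, ← LocalizedModule.zero_mk 1, eq_comm, LocalizedModule.mk_eq] at h0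
    obtain ⟨⟨u, hu⟩, h0⟩ := h0
    obtain ⟨N, rfl⟩ := exists_eq_pow_of_mem_cechSet _ hu
    refine ⟨N, ?_⟩
    simpa [Submonoid.smul_def] using h0
  choose N hN using hpow
  have hm0 : m = 0 := eq_zero_of_forall_pow_smul h hx hz hi hn hm (N := ∑ i, N i) fun i => by
    rw [← Nat.sub_add_cancel (Finset.single_le_sum (f := N) (fun _ _ => Nat.zero_le _)
      (Finset.mem_univ i)), pow_add, mul_smul, hN, smul_zero]
  change c = 0
  funext α
  obtain rfl : α = Fin.elim0 := Subsingleton.elim _ _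
  rw [hc, hm0, LocalizedModule.zero_mk]
  rfl

theorem subsingleton_cechH_one (h : IsGradedAction 𝒜 ℳ) (hx1 : ∀ i, x i ∈ 𝒜 1)
    (hx : Ideal.span (Set.range x) = irrelevant 𝒜) {β : ℕ} {z : R} (hz : z ∈ 𝒜 1)
    (hs : ∀ n, β ≤ n → ∀ m ∈ ℳ (n + 1), ∃ m' ∈ ℳ n, m = z • m')
    (hi : ∀ n, β < n → ∀ m ∈ ℳ n, z • m = 0 → m = 0) {n : ℕ} (hn : β ≤ n) :
    Subsingleton (CechH 𝒜 ℳ x n 1) := by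
  refine subsingleton_cechH ?_
  rintro c ⟨hdeg, hker⟩
  choose N₀ hN₀ using fun α : Fin 1 → Fin s => exists_eq_mk_pow h (hx1 (α 0)) (mem_cechSet α 0)
    (fun t ht => exists_eq_pow_of_mem_cechSet α ht) (hdeg α trivial)
  choose m hm hcm using fun α : Fin 1 → Fin s => hN₀ α (∑ α, N₀ α)
    (Finset.single_le_sum (f := N₀) (fun _ _ => Nat.zero_le _) (Finset.mem_univ α))
  set N := ∑ α, N₀ α
  have hcomp : ∀ γ : Fin 2 → Fin s, ∃ K, (x (γ 0) * x (γ 1)) ^ K •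
      (x (γ 0) ^ N • m (fun _ => γ 1) - x (γ 1) ^ N • m (fun _ => γ 0)) = 0 := by
    intro γ
    have h0 : cechD E x 1 c γ = 0 := congrFun (AddMonoidHom.mem_ker.1 hker) _
    simp only [cechD, LinearMap.pi_apply, LinearMap.sum_apply, LinearMap.smul_apply,
      LinearMap.comp_apply, LinearMap.proj_apply] at h0
    rw [Fin.sum_univ_two, hcm (fun l => γ ((0 : Fin 2).succAbove l)),
      hcm (fun l => γ ((1 : Fin 2).succAbove l)), LocalizedModule.liftOfLE_mk,
      LocalizedModule.liftOfLE_mk] at h0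
    simp only [Fin.val_zero, pow_zero, one_smul, Fin.val_one, pow_one, neg_smul,
      ← sub_eq_add_neg, sub_eq_zero] at h0
    rw [LocalizedModule.mk_eq] at h0
    obtain ⟨⟨u, hu⟩, h0⟩ := h0
    obtain ⟨K, v, hK⟩ := exists_dvd_pow_of_mem_cechSet γ hu
    have e0 : (fun l => γ ((0 : Fin 2).succAbove l)) = fun _ : Fin 1 => γ 1 := by
      funext l; fin_cases l; rfl
    have e1 : (fun l => γ ((1 : Fin 2).succAbove l)) = fun _ : Fin 1 => γ 0 := by
      funext l; fin_cases l; rfl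
    have h1 : u • x (γ 0) ^ N • m (fun _ => γ 1) = u • x (γ 1) ^ N • m (fun _ => γ 0) := by
      rw [← e0, ← e1]
      exact h0
    refine ⟨K, ?_⟩
    rw [hK, mul_comm, mul_smul, smul_sub u, h1, sub_self, smul_zero]
  choose K₀ hK₀ using hcomp
  -- A common exponent for all pairs. The summand 1 makes `K + N` positive, as gluing requires.
  set K := ∑ γ, K₀ γ + 1
  have hK : ∀ i j, (x i * x j) ^ K • (x i ^ N • m (fun _ => j) - x j ^ N • m (fun _ => i)) = 0 := by
    intro i j
    have h1 : K₀ ![i, j] ≤ K := (Finset.single_le_sum (f := K₀) (fun _ _ => Nat.zero_le _)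
      (Finset.mem_univ _)).trans (Nat.le_succ _)
    rw [← Nat.sub_add_cancel h1, pow_add, mul_smul]
    have h2 := hK₀ ![i, j]
    simp only [Matrix.cons_val_zero, Matrix.cons_val_one] at h2
    rw [h2, smul_zero]
  -- Rewriting m_i / x_i^N as x_i^K m_i / x_i^(K+N) makes the cocycle condition hold in E itself.
  obtain ⟨b, hb, hbm⟩ := exists_eq_pow_smul h hx1 hx hz hs hi hn (N := K + N)
    (by omega) (m := fun i => x i ^ K • m (fun _ => i))
    (fun i => by rw [add_assoc]; exact h.smul_mem (h.pow_mem (hx1 i) K) (hm _))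
    (fun i j => by
      have := hK i j
      rw [smul_sub, sub_eq_zero, smul_smul, smul_smul] at this
      rw [smul_smul, smul_smul]
      convert this using 2 <;> ring)
  refine ⟨fun α => LocalizedModule.mk b 1, fun α _ => AddSubgroup.subset_closure
    ⟨n, 0, b, 1, hb, h.one_mem, by simp, rfl⟩, ?_⟩
  funext α
  refine (cechD_zero_apply rfl α).trans ?_
  obtain ⟨i, rfl⟩ : ∃ i, α = fun _ => i := ⟨α 0, by funext l; fin_cases l; rfl⟩
  rw [hcm, LocalizedModule.mk_eq]
  refine ⟨⟨x i ^ K, Submonoid.pow_mem _ (mem_cechSet (fun _ : Fin 1 => i) 0) K⟩, ?_⟩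
  simp only [Submonoid.smul_def, one_smul, smul_smul]
  rw [← pow_add, hbm i]

end CechVanishing

/-! ### Dimension of a module finite over another ring -/

section SupportDim

/-- The dimension of a module that is finite over a subring. -/
theorem Module.supportDim_le_ringKrullDim_of_finite {T R E : Type*} [CommRing T] [CommRing R]
    [AddCommGroup E] [Module R E] (φ : T →+* R) {S : Set E} (hS : S.Finite)
    (hgen : ∀ W : AddSubmonoid E, S ⊆ W → (∀ t, ∀ e ∈ W, φ t • e ∈ W) → W = ⊤) :
    Module.supportDim R E ≤ ringKrullDim T := by
  let _ : Algebra T R := φ.toAlgebra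
  let _ : Module T E := Module.compHom E φ
  have : IsScalarTower T R E := ⟨fun t r e => by
    rw [Algebra.smul_def, mul_smul]; rfl⟩
  have : Module.Finite T E := by
    refine ⟨⟨hS.toFinset, ?_⟩⟩
    rw [Set.Finite.coe_toFinset, ← Submodule.toAddSubmonoid_inj]
    exact hgen _ Submodule.subset_span fun t e he => Submodule.smul_mem _ t he
  have : Module.Finite R E := Module.Finite.of_restrictScalars_finite T R E
  rw [Module.supportDim_eq_ringKrullDim_quotient_annihilator]
  -- By Cayley-Hamilton, every element of R satisfies on E a monic equation over T.
  have : Algebra.IsIntegral T (R ⧸ Module.annihilator R E) := by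
    refine ⟨fun r => ?_⟩
    obtain ⟨r, rfl⟩ := Ideal.Quotient.mk_surjective r
    obtain ⟨p, hp, hpr⟩ := LinearMap.exists_monic_and_aeval_eq_zero T (Algebra.lsmul T T E r)
    refine ⟨p, hp, ?_⟩
    rw [Polynomial.aeval_algHom_apply] at hpr
    have hmem : Polynomial.aeval r p ∈ Module.annihilator R E :=
      Module.mem_annihilator.2 fun e => LinearMap.congr_fun hpr e
    rw [← Polynomial.aeval_def, ← Ideal.Quotient.mkₐ_eq_mk T, Polynomial.aeval_algHom_apply,
      Ideal.Quotient.mkₐ_eq_mk]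
    exact Ideal.Quotient.eq_zero_iff_mem.2 hmem
  exact Order.krullDim_le_of_strictMono
    (PrimeSpectrum.comap (algebraMap T (R ⧸ Module.annihilator R E)))
    fun p q hpq => Ideal.IsIntegral.comap_lt_comap (I := p.asIdeal) (J := q.asIdeal) hpq

end SupportDim

/-! ### Initial forms and the regularity of G_I(M) -/

section AssociatedGraded

open AssocGr GradedCech
open scoped Pointwise

variable {A : Type*} [CommRing A] (I : Ideal A) (M : Type*) [AddCommGroup M] [Module A M]

/-- The initial form of degree `n` of an element of `I ^ n M`. -/
def initialForm {n : ℕ} {m : M} (hm : m ∈ powSub I M n) : Gr I M :=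
  DirectSum.of (Piece I M) n (cls I M n m hm)

variable {I M}

theorem exists_eq_initialForm {n : ℕ} {e : Gr I M} (he : e ∈ grDeg I M n) :
    ∃ (m : M) (hm : m ∈ powSub I M n), e = initialForm I M hm := by
  obtain ⟨e, rfl⟩ := he
  obtain ⟨⟨m, hm⟩, rfl⟩ := Submodule.Quotient.mk_surjective _ e
  exact ⟨m, hm, rfl⟩

theorem initialForm_mem {n : ℕ} {m : M} (hm : m ∈ powSub I M n) :
    initialForm I M hm ∈ grDeg I M n := ⟨_, rfl⟩

theorem gr_of_smul_of {i j : ℕ} (a : Piece I A i) (m : Piece I M j) :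
    DirectSum.of (Piece I A) i a • DirectSum.of (Piece I M) j m =
      DirectSum.of (Piece I M) (i + j) (pieceSMul I M i j a m) :=
  DirectSum.Gmodule.of_smul_of _ _ _ _

theorem initialForm_smul {i j : ℕ} {a : A} {m : M} (ha : a ∈ powSub I A i)
    (hm : m ∈ powSub I M j) :
    initialForm I A ha • initialForm I M hm = initialForm I M (smul_mem_powSub I ha hm) :=
  gr_of_smul_of _ _

theorem initialForm_mul {i j : ℕ} {a b : A} (ha : a ∈ powSub I A i) (hb : b ∈ powSub I A j) :
    initialForm I A ha * initialForm I A hb = initialForm I A (smul_mem_powSub I ha hb) :=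
  DirectSum.of_mul_of _ _

theorem initialForm_congr {i j : ℕ} (h : i = j) {m m' : M} (e : m = m') (hm : m ∈ powSub I M i)
    (hm' : m' ∈ powSub I M j) : initialForm I M hm = initialForm I M hm' := by
  subst h; subst e; rfl

theorem initialForm_add {n : ℕ} {m m' : M} (hm : m ∈ powSub I M n) (hm' : m' ∈ powSub I M n) :
    initialForm I M hm + initialForm I M hm' =
      initialForm I M (Submodule.add_mem _ hm hm') :=
  (map_add (DirectSum.of (Piece I M) n) _ _).symm

theorem initialForm_eq_zero_iff {n : ℕ} {m : M} (hm : m ∈ powSub I M n) :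
    initialForm I M hm = 0 ↔ m ∈ powSub I M (n + 1) := by
  rw [initialForm, map_eq_zero_iff _ (DirectSum.of_injective n), Submodule.Quotient.mk_eq_zero]
  rfl

theorem of_smul_component {i : ℕ} (k : ℕ) (a : Piece I A i) (e : Gr I M) :
    DirectSum.of (Piece I M) (i + k) ((DirectSum.of (Piece I A) i a • e) (i + k)) =
      DirectSum.of (Piece I A) i a • DirectSum.of (Piece I M) k (e k) := by
  have hadd : ∀ (g : Gr I A) (e e' : Gr I M), g • (e + e') = g • e + g • e' :=
    fun g e e' => by exact smul_add g e e'
  have hzero : ∀ g : Gr I A, g • (0 : Gr I M) = 0 := fun g => by exact smul_zero (A := Gr I M) g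
  induction e using DirectSum.induction_on with
  | zero => rw [hzero, DirectSum.zero_apply, DirectSum.zero_apply, map_zero, map_zero, hzero]
  | of l w =>
    rw [gr_of_smul_of]
    by_cases h : l = k
    · subst h
      rw [DirectSum.of_eq_same, DirectSum.of_eq_same, gr_of_smul_of]
    · rw [DirectSum.of_eq_of_ne _ _ _ (Ne.symm h), DirectSum.of_eq_of_ne, map_zero, map_zero,
        hzero]
      intro h'
      exact h (Nat.add_left_cancel h').symm
  | add e e' h h' =>
    rw [hadd, DirectSum.add_apply, DirectSum.add_apply, map_add, map_add, hadd, h, h']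

theorem isGradedAction_gr (I : Ideal A) (M : Type*) [AddCommGroup M] [Module A M] :
    IsGradedAction (R := Gr I A) (E := Gr I M) (grDeg I A) (grDeg I M) where
  one_mem := ⟨_, rfl⟩
  mul_mem := by
    rintro i j _ _ ⟨a, rfl⟩ ⟨b, rfl⟩
    rw [DirectSum.of_mul_of]
    exact ⟨_, rfl⟩
  smul_mem := by
    rintro i j _ _ ⟨a, rfl⟩ ⟨m, rfl⟩
    rw [gr_of_smul_of]
    exact ⟨_, rfl⟩
  eq_zero := by
    rintro i j _ ⟨a, rfl⟩ ⟨b, h⟩ hij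
    have := congrArg (fun f : Gr I A => f i) h
    simp only [DirectSum.of_eq_same] at this
    rw [← this, DirectSum.of_eq_of_ne _ _ _ hij, map_zero]
  exists_component := by
    intro e k
    refine ⟨_, ⟨e k, rfl⟩, ?_⟩
    rintro j _ _ ⟨a, rfl⟩ ⟨m, rfl⟩ h
    rw [← of_smul_component, h, DirectSum.of_eq_same]

/-- The ring homomorphism `A → G` with image the component of degree zero. -/
def toGr (I : Ideal A) : A →+* Gr I A where
  toFun a := initialForm I A (show a ∈ powSub I A 0 by simp [powSub])
  map_one' := rfl
  map_zero' := map_zero (DirectSum.of (Piece I A) 0)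
  map_add' a b := (initialForm_add _ _).symm
  map_mul' a b :=
    ((initialForm_mul _ _).trans (initialForm_congr (zero_add 0) rfl _ _)).symm

theorem toGr_smul (a : A) {n : ℕ} {m : M} (hm : m ∈ powSub I M n) :
    toGr I a • initialForm I M hm = initialForm I M (Submodule.smul_mem _ a hm) :=
  (initialForm_smul _ hm).trans (initialForm_congr (zero_add n) rfl _ _)

theorem mem_powSub_one {x : A} (hx : x ∈ I) : x ∈ powSub I A 1 := by
  simpa [powSub] using hx

theorem initialForm_smul_initialForm {x : A} (hx : x ∈ I) {n : ℕ} {m : M}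
    (hm : m ∈ powSub I M n) (hm' : x • m ∈ powSub I M (n + 1)) :
    initialForm I A (mem_powSub_one hx) • initialForm I M hm = initialForm I M hm' :=
  (initialForm_smul _ hm).trans (initialForm_congr (add_comm 1 n) rfl _ _)

theorem krullDimLE_zero_quotient [IsLocalRing A] (hI : I.radical = IsLocalRing.maximalIdeal A) :
    Ring.KrullDimLE 0 (A ⧸ I) := by
  refine Ring.KrullDimLE.mk₀ fun p hp => ?_
  have hle : I ≤ p.comap (Ideal.Quotient.mk I) := by
    rw [← Ideal.map_le_iff_le_comap, Ideal.map_quotient_self]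
    exact bot_le
  have hpc : (p.comap (Ideal.Quotient.mk I)).IsPrime := hp.comap _
  have hmax : p.comap (Ideal.Quotient.mk I) = IsLocalRing.maximalIdeal A :=
    le_antisymm (IsLocalRing.le_maximalIdeal hpc.ne_top) (by rwa [← hI, hpc.radical_le_iff])
  have : (p.comap (Ideal.Quotient.mk I)).IsMaximal := hmax ▸ inferInstance
  have h := Ideal.map_eq_top_or_isMaximal_of_surjective (Ideal.Quotient.mk I)
    Ideal.Quotient.mk_surjective this
  rw [Ideal.map_comap_of_surjective _ Ideal.Quotient.mk_surjective] at h
  exact h.resolve_left hp.ne_top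

/-- Sending X to the initial form of x makes G_I(M) a finite module over (A/I)[X], generated in
degrees at most β; that ring has dimension at most 1 because A/I has dimension at most 0. -/
theorem supportDim_gr_le_one [IsLocalRing A] [IsNoetherianRing A] [Module.Finite A M]
    (hI : I.radical = IsLocalRing.maximalIdeal A) {x : A} (hx : x ∈ I) {β : ℕ}
    (hβ : ∀ n, β ≤ n → powSub I M (n + 1) = x • powSub I M n) :
    Module.supportDim (Gr I A) (Gr I M) ≤ 1 := by
  have hker : ∀ a ∈ I, toGr I a = 0 := fun a ha =>
    (initialForm_eq_zero_iff _).2 (mem_powSub_one ha)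
  let φ : Polynomial (A ⧸ I) →+* Gr I A :=
    Polynomial.eval₂RingHom (Ideal.Quotient.lift I (toGr I) hker)
      (initialForm I A (mem_powSub_one hx))
  have hφC : ∀ a, φ (Polynomial.C (Ideal.Quotient.mk I a)) = toGr I a := fun a => by
    rw [Polynomial.coe_eval₂RingHom, Polynomial.eval₂_C, Ideal.Quotient.lift_mk]
  have hφX : φ Polynomial.X = initialForm I A (mem_powSub_one hx) := by
    rw [Polynomial.coe_eval₂RingHom, Polynomial.eval₂_X]
  choose s hs using fun n => (IsNoetherian.noetherian (⊤ : Submodule A (powSub I M n)))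
  have hdim : ringKrullDim (Polynomial (A ⧸ I)) ≤ 1 := by
    have := (Ring.krullDimLE_iff (n := 0) (R := A ⧸ I)).1 (krullDimLE_zero_quotient hI)
    rw [Polynomial.ringKrullDim_of_isNoetherianRing]
    simpa using add_le_add_left this 1
  refine (Module.supportDim_le_ringKrullDim_of_finite φ
    (S := ⋃ n ∈ Finset.range (β + 1), (fun m : powSub I M n => initialForm I M m.2) '' (s n))
    (Set.Finite.biUnion (Finset.finite_toSet _) fun n _ => (Finset.finite_toSet _).image _)
    fun W hSW hW => ?_).trans hdim
  have hlow : ∀ n ≤ β, ∀ m : powSub I M n, initialForm I M m.2 ∈ W := by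
    intro n hn m
    have hm : m ∈ Submodule.span A (s n : Set (powSub I M n)) := by rw [hs n]; trivial
    induction hm using Submodule.span_induction with
    | mem m hm => exact hSW (Set.mem_biUnion (Finset.mem_range.2 (by omega)) ⟨m, hm, rfl⟩)
    | zero =>
      rw [(initialForm_eq_zero_iff _).2 (Submodule.zero_mem _)]
      exact W.zero_mem
    | add m m' _ _ h h' => exact (initialForm_add m.2 m'.2) ▸ W.add_mem h h'
    | smul a m _ h =>
      have := hW (Polynomial.C (Ideal.Quotient.mk I a)) _ h
      rwa [hφC, toGr_smul] at this
  have hall : ∀ n, ∀ m : powSub I M n, initialForm I M m.2 ∈ W := by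
    intro n
    induction n with
    | zero => exact hlow 0 (Nat.zero_le _)
    | succ n ih =>
      rcases Nat.lt_or_ge β (n + 1) with h | h
      · rintro ⟨m, hm⟩
        obtain ⟨w, hw, rfl⟩ := (Submodule.mem_smul_pointwise_iff_exists _ _ _).1
          ((hβ n (by omega)) ▸ hm)
        have := hW Polynomial.X _ (ih ⟨w, hw⟩)
        rwa [hφX, initialForm_smul_initialForm hx hw hm] at this
      · exact hlow _ h
  rw [eq_top_iff]
  intro e _
  induction e using DirectSum.induction_on with
  | zero => exact W.zero_mem
  | of n w =>
    obtain ⟨m, rfl⟩ := Submodule.Quotient.mk_surjective _ w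
    exact hall n m
  | add e e' h h' => exact W.add_mem (h trivial) (h' trivial)

/-- The bound on the regularity of `G_I(M)` in terms of a reduction of degree one. -/
theorem regGr_le [IsLocalRing A] [IsNoetherianRing A] [Module.Finite A M]
    (hI : I.radical = IsLocalRing.maximalIdeal A) {x : A} (hx : x ∈ I) {β : ℕ}
    (hβ : ∀ n, β ≤ n → powSub I M (n + 1) = x • powSub I M n)
    (hinj : ∀ n, β < n → ∀ m ∈ powSub I M n, x • m ∈ powSub I M (n + 2) →
      m ∈ powSub I M (n + 1)) : regGr I M ≤ ((β : ℝ) : EReal) := by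
  have hz : initialForm I A (mem_powSub_one hx) ∈ grDeg I A 1 := initialForm_mem _
  have hs : ∀ n, β ≤ n → ∀ e ∈ grDeg I M (n + 1), ∃ e' ∈ grDeg I M n,
      e = initialForm I A (mem_powSub_one hx) • e' := by
    intro n hn e he
    obtain ⟨m, hm, rfl⟩ := exists_eq_initialForm he
    obtain ⟨w, hw, rfl⟩ := (Submodule.mem_smul_pointwise_iff_exists _ _ _).1 (hβ n hn ▸ hm)
    exact ⟨_, initialForm_mem hw, (initialForm_smul_initialForm hx hw hm).symm⟩
  have hi : ∀ n, β < n → ∀ e ∈ grDeg I M n,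
      initialForm I A (mem_powSub_one hx) • e = 0 → e = 0 := by
    intro n hn e he h0
    obtain ⟨m, hm, rfl⟩ := exists_eq_initialForm he
    rw [initialForm_smul_initialForm hx hm (by
      rw [hβ n hn.le]; exact Submodule.smul_mem_pointwise_smul _ _ _ hm),
      initialForm_eq_zero_iff] at h0
    exact (initialForm_eq_zero_iff hm).2 (hinj n hn m hm h0)
  have hgr := isGradedAction_gr I M
  rw [regGr, regularity]
  refine iSup₂_le fun p hp => ?_
  have hp1 : p ≤ 1 := by
    have := hp.trans (supportDim_gr_le_one hI hx hβ)
    exact_mod_cast this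
  have haInv : ∀ c : ℤ, (∀ n : ℤ, c < n → ¬ LocalCohomologyNonzero
      (R := Gr I A) (E := Gr I M) (grDeg I A) (grDeg I M) p n) →
      aInv (R := Gr I A) (E := Gr I M) (grDeg I A) (grDeg I M) p ≤ ((c : ℝ) : EReal) := fun c hc =>
    iSup₂_le fun n hn => by
      rw [EReal.coe_le_coe_iff, Int.cast_le]
      by_contra! h
      exact hc n h hn
  rcases Nat.le_one_iff_eq_zero_or_eq_one.1 hp1 with rfl | rfl
  · have := haInv β (by
      rintro n hn ⟨s, y, -, hy, hnt⟩
      obtain ⟨k, rfl⟩ := Int.eq_ofNat_of_zero_le (show 0 ≤ n by omega)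
      have := subsingleton_cechH_zero hgr hy hz hi (show β < k by omega)
      exact not_subsingleton _ this)
    simpa using this
  -- H^1 vanishes already in degree β, which offsets the shift by 1 in the regularity.
  · have := haInv (β - 1) (by
      rintro n hn ⟨s, y, hy1, hy, hnt⟩
      obtain ⟨k, rfl⟩ := Int.eq_ofNat_of_zero_le (show 0 ≤ n by omega)
      have := subsingleton_cechH_one hgr hy1 hy hz hs hi (show β ≤ k by omega)
      exact not_subsingleton _ this)
    refine (add_le_add_left this _).trans (le_of_eq ?_)
    have hcast : (((β : ℤ) - 1 : ℤ) : ℝ) = (β : ℝ) - 1 := by push_cast; rfl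
    rw [hcast, Nat.cast_one, ← EReal.coe_one, ← EReal.coe_add, sub_add_cancel]

end AssociatedGraded

/-! ### Hilbert coefficients in dimension one -/

section HilbertCoefficients

open HilbertSamuel AssocGr

variable {A : Type*} [CommRing A] {M : Type*} [AddCommGroup M] [Module A M] {I : Ideal A}

theorem hilbertFun_eq_colength (n : ℕ) : hilbertFun I M n = colength (powSub I M (n + 1)) := rfl

theorem HilbertSamuel.dim_eq_one (hM : Module.supportDim A M = 1) : HilbertSamuel.dim A M = 1 := by
  rw [HilbertSamuel.dim, hM]
  rfl

theorem isHilbertCoeffs_iff (hM : Module.supportDim A M = 1) (e : ℕ → ℤ) :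
    IsHilbertCoeffs I M e ↔ (∀ i, 1 < i → e i = 0) ∧ ∀ᶠ n : ℕ in Filter.atTop,
      (colength (powSub I M (n + 1)) : ℤ) = e 0 * (n + 1) - e 1 := by
  rw [IsHilbertCoeffs, HilbertSamuel.dim_eq_one hM]
  refine and_congr_right fun _ => Filter.eventually_congr (Filter.Eventually.of_forall fun n => ?_)
  rw [hilbertFun_eq_colength, Finset.sum_range_succ, Finset.sum_range_one]
  simp [sub_eq_add_neg]

/-- The Hilbert coefficients of a module of dimension one. -/
theorem hilbertCoeff_eq (hM : Module.supportDim A M = 1) {e₀ e₁ : ℤ}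
    (h : ∀ᶠ n : ℕ in Filter.atTop, (colength (powSub I M (n + 1)) : ℤ) = e₀ * (n + 1) - e₁) :
    hilbertCoeff I M 0 = e₀ ∧ hilbertCoeff I M 1 = e₁ := by
  have hex : ∃ e : ℕ → ℤ, IsHilbertCoeffs I M e := by
    refine ⟨fun i => if i = 0 then e₀ else if i = 1 then e₁ else 0,
      (isHilbertCoeffs_iff hM _).2 ⟨fun i hi => ?_, by simpa using h⟩⟩
    rw [if_neg (by omega), if_neg (by omega)]
  have hspec : IsHilbertCoeffs I M (hilbertCoeff I M) := by
    rw [hilbertCoeff, dif_pos hex]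
    exact hex.choose_spec
  -- Two consecutive large values determine a linear polynomial, so the chosen coefficients are the
  -- given ones.
  obtain ⟨N, hN⟩ := Filter.eventually_atTop.1 (((isHilbertCoeffs_iff hM _).1 hspec).2.and h)
  have h1 := hN N le_rfl
  have h2 := hN (N + 1) (Nat.le_succ N)
  have h3 := h1.1.symm.trans h1.2
  have h4 := h2.1.symm.trans h2.2
  push_cast at h4
  have h0 : hilbertCoeff I M 0 = e₀ := by linarith
  rw [h0] at h3
  exact ⟨h0, by linarith⟩

end HilbertCoefficients

theorem theorem2 {A : Type*} [CommRing A] [IsLocalRing A] [IsNoetherianRing A]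
    [Infinite (IsLocalRing.ResidueField A)]
    {M : Type*} [AddCommGroup M] [Module A M] [Module.Finite A M]
    (hM : Module.supportDim A M = 1)
    (I : Ideal A) (hI : I.radical = IsLocalRing.maximalIdeal A)
    (b : ℕ)
    (hb : IsGreatest {c : ℕ | I • (⊤ : Submodule A M) ≤
      IsLocalRing.maximalIdeal A ^ c • (⊤ : Submodule A M)} b) :
    regGr I M ≤
      (((Ring.choose (HilbertSamuel.hilbertCoeff I M 0 - (b : ℤ) + 2) 2
        - HilbertSamuel.hilbertCoeff I M 1 - 1 : ℤ) : ℝ) : EReal) := by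
  have hIm : I ≤ IsLocalRing.maximalIdeal A := hI ▸ Ideal.le_radical
  have hb1 : 1 ≤ b := hb.2 (show I • (⊤ : Submodule A M) ≤ IsLocalRing.maximalIdeal A ^ 1 • ⊤ by
    rw [pow_one]; exact Submodule.smul_mono_left hIm)
  -- `exists_regularity_bound` is applied with `c`, one less than the exponent of 𝔪.
  obtain ⟨c, rfl⟩ := Nat.exists_eq_add_of_le' hb1
  obtain ⟨β, x, hx, e₀, e₁, hilb, hβ, hinj, he, hbound⟩ := exists_regularity_bound hM hI hb.1
  obtain ⟨h0, h1⟩ := hilbertCoeff_eq (e₀ := (e₀ : ℤ)) hM hilb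
  refine (regGr_le hI hx hβ hinj).trans ?_
  rw [h0, h1, EReal.coe_le_coe_iff, ← Int.cast_natCast, Int.cast_le]
  -- With d = e₀ - b ≥ 0, the integer binomial becomes the natural number (d+2)(d+1)/2.
  obtain ⟨d, rfl⟩ := Nat.exists_eq_add_of_le he
  have hd : ((c + 1 + d : ℕ) : ℤ) - ((c + 1 : ℕ) : ℤ) + 2 = ((d + 2 : ℕ) : ℤ) := by
    push_cast; ring
  rw [hd, Ring.choose_natCast]
  have htwo : ((d + 2).choose 2 : ℤ) * 2 = (d + 2) * (d + 1) := by
    have : (d + 2).choose 2 * 2 = (d + 2) * (d + 1) := by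
      rw [← Nat.add_one_mul_choose_eq (d + 1) 1, Nat.choose_one_right]
    exact_mod_cast this
  push_cast at hbound
  have : ((c : ℤ) + 1 + d - c + 1) * (c + 1 + d - c) = (d + 2) * (d + 1) := by ring
  rw [this] at hbound
  linarith
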